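/- Let $(\Omega,\mathcal F,\mathbb P)$ be a nonatomic probability space, let $L^1$ be the space of integrable random variables modulo almost sure equality, and let $\mathcal L\subset L^1$ be the space of simple random variables. Let $\Pi$ be the set of finite measurable partitions $\pi$ of $\Omega$ all of whose members have positive probability, and write $\mathbb E[X|\pi]$ for the conditional expectation of $X\in L^1$ given the $\sigma$-algebra generated by $\pi$. For $\mathcal S\subset L^1$ let $\mathcal I(\mathcal S)$ be the smallest ideal of $L^1$ containing $\mathcal S$ (the set of $X\in L^1$ with $|X|\le\sum_{i=1}^n\lambda_i|X_i|$ a.s. for some $n$, $X_i\in\mathcal S$ and $\lambda_i\ge 0$). For $\mathcal Y\subset L^1$, a functional $\rho:\mathcal Y\to(-\infty,\infty]$ is called - dilatation monotone if $\rho(\mathbb E[X|\pi])\le\rho(X)$ for all $X\in\mathcal Y$ and $\pi\in\Pi$ (used when $\mathcal L\subset\mathcal Y$); - law-invariant if $\rho(X)=\rho(Y)$ whenever $X,Y\in\mathcal Y$ have the same distribution; - convex (resp. quasiconvex) if $\rho(\lambda X+(1-\lambda)Y)\le\lambda\rho(X)+(1-\lambda)\rho(Y)$ (resp. $\le\max\{\rho(X),\rho(Y)\}$)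 for all $X,Y\in\mathcal Y$ and $\lambda\in(0,1)$ with $\lambda X+(1-\lambda)Y\in\mathcal Y$; - cash-additive if $\rho(X+s)=\rho(X)-s$ for all $X\in\mathcal Y$ and $s\in\mathbb R$ with $X+s\in\mathcal Y$; - monotone if $\rho(X)\le\rho(Y)$ for all $X,Y\in\mathcal Y$ with $X\ge Y$ a.s.; - to have the Fatou property if $\rho(X)\le\liminf_n\rho(X_n)$ whenever $X_n,X\in\mathcal Y$, $X_n\to X$ a.s. and $\sup_n|X_n|\in\mathcal I(\mathcal Y)$. Let $\mathcal X\subset L^1$ be a convex set such that $\mathcal X+\mathcal X\subset\mathcal X$, $L^\infty\subset\mathcal X$, and $X\mathbb 1_A\in\mathcal X$ for all $X\in\mathcal X$ and $A\in\mathcal F$. Let $\rho:\mathcal X\to(-\infty,\infty]$ be quasiconvex and law-invariant with the Fatou property, and put $$\overline\rho(X)=\sup_{\pi\in\Pi}\rho(\mathbb E[X|\pi]),\qquad X\in L^1.$$ Then $\rho$ is dilatation monotone. Moreover, $\overline\rho$ takes values in $(-\infty,\infty]$, agrees with $\rho$ on $\mathcal X$, and is quasiconvex, law-invariant, dilatation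 monotone and $\sigma(L^1,\mathcal L)$ lower semicontinuous on $L^1$ (that is, $\{\overline\rho\le\lambda\}$ is closed, for every $\lambda\in\mathbb R$, in the coarsest topology on $L^1$ making $X\mapsto\mathbb E[XY]$ continuous for each $Y\in\mathcal L$). Finally, if $\rho$ is monotone (resp. convex, cash-additive) on $\mathcal X$, then $\overline\rho$ is monotone (resp. convex, cash-additive) on $L^1$. -/

import Mathlib

open MeasureTheory ProbabilityTheory Filter Topology
open scoped ENNReal

noncomputable section

namespace RiskExtension

variable {Ω : Type*} [MeasurableSpace Ω]

/-- A measure is nonatomic if every measurable set of positive measure has a measurable subset of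
strictly smaller positive measure. -/
def Nonatomic (P : Measure Ω) : Prop :=
  ∀ A : Set Ω, MeasurableSet A → 0 < P A →
    ∃ B : Set Ω, B ⊆ A ∧ MeasurableSet B ∧ 0 < P B ∧ P B < P A

/-- The collection `Π` of finite measurable partitions of `Ω` whose members have non-zero
probabilities. -/
structure FinPartition (P : Measure Ω) where
  parts : Finset (Set Ω)
  measurableSet_of_mem : ∀ A ∈ parts, MeasurableSet A
  measure_ne_zero : ∀ A ∈ parts, P A ≠ 0
  pairwiseDisjoint : (parts : Set (Set Ω)).PairwiseDisjoint id
  sUnion_eq : ⋃₀ (parts : Set (Set Ω)) = Set.univ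

/-- The σ-algebra `σ(π)` generated by a partition. -/
abbrev FinPartition.sigma {P : Measure Ω} (π : FinPartition P) : MeasurableSpace Ω :=
  MeasurableSpace.generateFrom (π.parts : Set (Set Ω))

/-- `σ(π)` is a sub-σ-algebra, so that Mathlib's conditional expectation is the genuine one. -/
theorem FinPartition.sigma_le {P : Measure Ω} (π : FinPartition P) :
    π.sigma ≤ (inferInstance : MeasurableSpace Ω) :=
  MeasurableSpace.generateFrom_le fun A hA => π.measurableSet_of_mem A hA

/-- The conditional expectation `E[X | π] = E[X | σ(π)]`, as an element of `L¹`. -/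
def condE {P : Measure Ω} (π : FinPartition P) (X : Ω →₁[P] ℝ) : Ω →₁[P] ℝ :=
  (integrable_condExp (m := π.sigma) (μ := P) (f := (X : Ω → ℝ))).toL1 _

/-- The product `X 1_A` of an element of `L¹` with an indicator function. -/
def mulIndicator {P : Measure Ω} (X : Ω →₁[P] ℝ) (A : Set Ω) (hA : MeasurableSet A) :
    Ω →₁[P] ℝ :=
  ((L1.integrable_coeFn X).indicator hA).toL1 (A.indicator (X : Ω → ℝ))

/-- The ideal of `L¹` generated by `S`: all `X` with `|X| ≤ ∑ i, c i |Y i|` for finitely many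
`Y i ∈ S` and `c i ≥ 0`. -/
def idealGen {P : Measure Ω} (S : Set (Ω →₁[P] ℝ)) : Set (Ω →₁[P] ℝ) :=
  {X | ∃ (n : ℕ) (Y : Fin n → (Ω →₁[P] ℝ)) (c : Fin n → ℝ),
    (∀ i, Y i ∈ S) ∧ (∀ i, 0 ≤ c i) ∧ |X| ≤ ∑ i, c i • |Y i|}

/-- `ρ` is dilatation monotone on `D`. -/
def DilatationMonotoneOn {P : Measure Ω} (D : Set (Ω →₁[P] ℝ)) (ρ : (Ω →₁[P] ℝ) → EReal) : Prop :=
  ∀ X ∈ D, ∀ π : FinPartition P, ρ (condE π X) ≤ ρ X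

/-- `ρ` is law-invariant on `D`. -/
def LawInvariantOn {P : Measure Ω} (D : Set (Ω →₁[P] ℝ)) (ρ : (Ω →₁[P] ℝ) → EReal) : Prop :=
  ∀ X ∈ D, ∀ Y ∈ D, IdentDistrib (X : Ω → ℝ) (Y : Ω → ℝ) P P → ρ X = ρ Y

/-- `ρ` is convex on `D`. -/
def RiskConvexOn {P : Measure Ω} (D : Set (Ω →₁[P] ℝ)) (ρ : (Ω →₁[P] ℝ) → EReal) : Prop :=
  ∀ X ∈ D, ∀ Y ∈ D, ∀ t : ℝ, 0 < t → t < 1 → t • X + (1 - t) • Y ∈ D →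
    ρ (t • X + (1 - t) • Y) ≤ (t : EReal) * ρ X + ((1 - t : ℝ) : EReal) * ρ Y

/-- `ρ` is quasiconvex on `D`. -/
def RiskQuasiconvexOn {P : Measure Ω} (D : Set (Ω →₁[P] ℝ)) (ρ : (Ω →₁[P] ℝ) → EReal) : Prop :=
  ∀ X ∈ D, ∀ Y ∈ D, ∀ t : ℝ, 0 < t → t < 1 → t • X + (1 - t) • Y ∈ D →
    ρ (t • X + (1 - t) • Y) ≤ max (ρ X) (ρ Y)

/-- `ρ` is cash-additive on `D`. -/
def CashAdditiveOn {P : Measure Ω} [IsFiniteMeasure P] (D : Set (Ω →₁[P] ℝ))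
    (ρ : (Ω →₁[P] ℝ) → EReal) : Prop :=
  ∀ X ∈ D, ∀ s : ℝ, X + Lp.const 1 P s ∈ D → ρ (X + Lp.const 1 P s) = ρ X - (s : EReal)

/-- `ρ` is monotone on `D` (in the sense of risk measures: larger positions are less risky). -/
def RiskMonotoneOn {P : Measure Ω} (D : Set (Ω →₁[P] ℝ)) (ρ : (Ω →₁[P] ℝ) → EReal) : Prop :=
  ∀ X ∈ D, ∀ Y ∈ D, Y ≤ X → ρ X ≤ ρ Y

/-- The Fatou property of `ρ` on `D`. Here `Z` is the supremum of the `|X n|`, and the condition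
is that it belongs to the ideal generated by `D`. -/
def FatouOn {P : Measure Ω} (D : Set (Ω →₁[P] ℝ)) (ρ : (Ω →₁[P] ℝ) → EReal) : Prop :=
  ∀ (X : ℕ → (Ω →₁[P] ℝ)) (X₀ : Ω →₁[P] ℝ), (∀ n, X n ∈ D) → X₀ ∈ D →
    (∀ᵐ ω ∂P, Tendsto (fun n => X n ω) atTop (𝓝 (X₀ ω))) →
    (∃ Z ∈ idealGen D, ∀ᵐ ω ∂P, IsLUB (Set.range fun n => |X n ω|) (Z ω)) →
    ρ X₀ ≤ liminf (fun n => ρ (X n)) atTop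

/-- The topology `σ(L¹, 𝓛)`: the coarsest one making all the functionals `X ↦ E[X g]`, with `g` a
simple random variable, continuous. -/
abbrev sigmaTopology (P : Measure Ω) : TopologicalSpace (Ω →₁[P] ℝ) :=
  TopologicalSpace.induced (fun X (g : SimpleFunc Ω ℝ) => ∫ ω, X ω * g ω ∂P) Pi.topologicalSpace

/-- `ρ` is `σ(L¹, 𝓛)` lower semicontinuous on `L¹`: its sublevel sets are closed. -/
def SigmaLowerSemicontinuous {P : Measure Ω} (ρ : (Ω →₁[P] ℝ) → EReal) : Prop :=
  ∀ r : ℝ, IsClosed[sigmaTopology P] {X | ρ X ≤ (r : EReal)}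

/-- The extension `ρ̄(X) = sup_π ρ(E[X | π])`. -/
def extend {P : Measure Ω} (ρ : (Ω →₁[P] ℝ) → EReal) (X : Ω →₁[P] ℝ) : EReal :=
  ⨆ π : FinPartition P, ρ (condE π X)

end RiskExtension

end

namespace RiskExtension

variable {Ω : Type*} [MeasurableSpace Ω]

/-! The core is dilatation monotonicity. Let `X` be bounded on a set `B` of positive probability.
Nonatomicity provides i.i.d. variables having, given `B`, the conditional law of `X`. Substituting
one of them for `X` on `B` keeps the law, hence `ρ`; averages of such copies stay in the sublevel
set by quasiconvexity, and by the strong law they converge a.s. to `X` with its values on `B`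
replaced by their mean. The Fatou property gives `average_le`. Boundedness on `B` matters because
the domain is not assumed law-invariant: it keeps the copies in the domain and their averages
dominated by `|X| + c`. Averaging on the sets `A ∩ {|X| ≤ k}`, `A` a cell, and letting `k → ∞`
yields `ρ(E[X|π]) ≤ ρ(X)`.

The converse `ρ ≤ ρ̄` on the domain needs partitions with `E[X|π_n] → X` a.s. under domination.
Discretizing the values of `X` is not enough, since the mean over a tail cell may be arbitrarily
large. In `exists_condE_approx` the tail is therefore merged with a set of small but fixed
probability on which `X` is bounded, which keeps the mean bounded; Borel–Cantelli then gives
convergence.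

On all of `L¹`, `E[X|π]` depends only on finitely many cell integrals, and Fatou makes `ρ(E[X|π])`
lower semicontinuous in them (`condE_le_liminf`). Semicontinuity of `ρ̄` follows, and so does
law-invariance, by approximating `X` in `L¹` with conditional expectations that are functions of `X`
determined by its law. The other properties pass through linearity and monotonicity of conditional
expectation and through the supremum. -/

/-! ### Nonatomic measures: intermediate values, uniform variables, i.i.d. sequences. -/

theorem Nonatomic.restrict {μ : Measure Ω} (hμ : Nonatomic μ) {B : Set Ω}
    (hB : MeasurableSet B) : Nonatomic (μ.restrict B) := by
  intro A hA hpos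
  rw [Measure.restrict_apply hA] at hpos ⊢
  obtain ⟨C, hCA, hC, hC0, hC1⟩ := hμ (A ∩ B) (hA.inter hB) hpos
  refine ⟨C, hCA.trans Set.inter_subset_left, hC, ?_⟩
  rw [Measure.restrict_apply hC, Set.inter_eq_left.2 (hCA.trans Set.inter_subset_right)]
  exact ⟨hC0, hC1⟩

theorem Nonatomic.smul {μ : Measure Ω} (hμ : Nonatomic μ) {c : ℝ≥0∞} (hc0 : c ≠ 0)
    (hc : c ≠ ∞) : Nonatomic (c • μ) := by
  intro A hA hpos
  simp only [Measure.smul_apply, smul_eq_mul] at hpos ⊢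
  obtain ⟨C, hCA, hC, hC0, hC1⟩ := hμ A hA (pos_iff_ne_zero.2 (right_ne_zero_of_mul hpos.ne'))
  exact ⟨C, hCA, hC, ENNReal.mul_pos hc0 hC0.ne', (ENNReal.mul_lt_mul_iff_right hc0 hc).2 hC1⟩

theorem Nonatomic.cond {μ : Measure Ω} [IsFiniteMeasure μ] (hμ : Nonatomic μ) {B : Set Ω}
    (hB : MeasurableSet B) (hB0 : μ B ≠ 0) : Nonatomic μ[|B] :=
  (hμ.restrict hB).smul (ENNReal.inv_ne_zero.2 (measure_ne_top _ _)) (ENNReal.inv_ne_top.2 hB0)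

theorem Nonatomic.exists_le_half {μ : Measure Ω} [IsFiniteMeasure μ] (hμ : Nonatomic μ)
    {A : Set Ω} (hA : MeasurableSet A) (hpos : 0 < μ A) :
    ∃ B ⊆ A, MeasurableSet B ∧ 0 < μ B ∧ μ B ≤ μ A / 2 := by
  obtain ⟨B, hBA, hB, hB0, hB1⟩ := hμ A hA hpos
  rcases le_total (μ B) (μ A / 2) with h | h
  · exact ⟨B, hBA, hB, hB0, h⟩
  · refine ⟨A \ B, Set.sdiff_subset, hA.diff hB, ?_, ?_⟩
    · rw [measure_sdiff hBA hB.nullMeasurableSet (measure_ne_top _ _)]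
      exact tsub_pos_of_lt hB1
    · rw [measure_sdiff hBA hB.nullMeasurableSet (measure_ne_top _ _)]
      calc μ A - μ B ≤ μ A - μ A / 2 := tsub_le_tsub_left h _
        _ = μ A / 2 := ENNReal.sub_half (measure_ne_top _ _)

theorem Nonatomic.exists_small {μ : Measure Ω} [IsFiniteMeasure μ] (hμ : Nonatomic μ)
    {A : Set Ω} (hA : MeasurableSet A) (hpos : 0 < μ A) {ε : ℝ≥0∞} (hε : 0 < ε) :
    ∃ B ⊆ A, MeasurableSet B ∧ 0 < μ B ∧ μ B ≤ ε := by
  have key : ∀ n : ℕ, ∃ B ⊆ A, MeasurableSet B ∧ 0 < μ B ∧ μ B ≤ μ A * (2⁻¹ : ℝ≥0∞) ^ n := by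
    intro n
    induction n with
    | zero => exact ⟨A, subset_rfl, hA, hpos, by simp⟩
    | succ n ih =>
      obtain ⟨B, hBA, hB, hB0, hB1⟩ := ih
      obtain ⟨C, hCB, hC, hC0, hC1⟩ := hμ.exists_le_half hB hB0
      refine ⟨C, hCB.trans hBA, hC, hC0, hC1.trans ?_⟩
      rw [pow_succ, ← mul_assoc, ENNReal.div_eq_inv_mul, mul_comm]
      gcongr
  have hlim : Tendsto (fun n : ℕ => μ A * (2⁻¹ : ℝ≥0∞) ^ n) atTop (𝓝 (μ A * 0)) :=
    ENNReal.Tendsto.const_mul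
      (ENNReal.tendsto_pow_atTop_nhds_zero_of_lt_one (by norm_num)) (Or.inr (measure_ne_top _ _))
  rw [mul_zero] at hlim
  obtain ⟨n, hn⟩ := (hlim.eventually_le_const hε).exists
  obtain ⟨B, h1, h2, h3, h4⟩ := key n
  exact ⟨B, h1, h2, h3, h4.trans hn⟩

/-- Sierpiński: a nonatomic finite measure takes all intermediate values. -/
theorem Nonatomic.exists_measure_eq {μ : Measure Ω} [IsFiniteMeasure μ] (hμ : Nonatomic μ)
    {A : Set Ω} (hA : MeasurableSet A) {t : ℝ≥0∞} (ht : t ≤ μ A) :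
    ∃ B ⊆ A, MeasurableSet B ∧ μ B = t := by
  classical
  -- Greedy exhaustion: `C` has at least half the largest measure that can be added to `B` without
  -- exceeding `t`.
  have step : ∀ B : Set Ω, ∃ C ⊆ A \ B, MeasurableSet C ∧ (μ B ≤ t → μ B + μ C ≤ t) ∧
      ∀ C' ⊆ A \ B, MeasurableSet C' → μ B + μ C' ≤ t → μ C' ≤ 2 * μ C := by
    intro B
    by_cases hBt : μ B ≤ t
    swap
    · exact ⟨∅, by simp, MeasurableSet.empty, fun h => absurd h hBt,
        fun C' _ _ h => absurd (le_self_add.trans h) hBt⟩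
    let S : Set ℝ≥0∞ := {x | ∃ C ⊆ A \ B, MeasurableSet C ∧ μ B + μ C ≤ t ∧ μ C = x}
    have hStop : sSup S ≠ ∞ := by
      refine ne_top_of_le_ne_top (measure_ne_top μ Set.univ) (sSup_le ?_)
      rintro x ⟨C, -, -, -, rfl⟩
      exact measure_mono (Set.subset_univ _)
    by_cases h0 : sSup S = 0
    · refine ⟨∅, by simp, MeasurableSet.empty, fun h => by simpa using h, fun C' h1 h2 h3 => ?_⟩
      have : μ C' ≤ sSup S := le_sSup ⟨C', h1, h2, h3, rfl⟩
      rw [h0] at this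
      exact this.trans (by simp)
    · obtain ⟨x, ⟨C, h1, h2, h3, rfl⟩, hx⟩ := lt_sSup_iff.1 (ENNReal.half_lt_self h0 hStop)
      refine ⟨C, h1, h2, fun _ => h3, fun C' h1' h2' h3' => ?_⟩
      have hle : μ C' ≤ sSup S := le_sSup ⟨C', h1', h2', h3', rfl⟩
      calc μ C' ≤ sSup S := hle
        _ = 2 * (sSup S / 2) := (ENNReal.mul_div_cancel (by norm_num) (by norm_num)).symm
        _ ≤ 2 * μ C := by gcongr
  choose f hf1 hf2 hf3 hf4 using step
  let B : ℕ → Set Ω := fun n => Nat.rec ∅ (fun _ s => s ∪ f s) n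
  have hBs : ∀ n, B (n + 1) = B n ∪ f (B n) := fun n => rfl
  have hmono : Monotone B := monotone_nat_of_le_succ fun n => by
    rw [hBs]; exact Set.subset_union_left
  have hBA : ∀ n, B n ⊆ A := by
    intro n
    induction n with
    | zero => exact Set.empty_subset _
    | succ n ih => rw [hBs]; exact Set.union_subset ih ((hf1 _).trans Set.sdiff_subset)
  have hBm : ∀ n, MeasurableSet (B n) := by
    intro n
    induction n with
    | zero => exact MeasurableSet.empty
    | succ n ih => rw [hBs]; exact ih.union (hf2 _)
  have hBadd : ∀ n, μ (B (n + 1)) = μ (B n) + μ (f (B n)) := by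
    intro n
    rw [hBs, measure_union _ (hf2 _)]
    exact (Set.disjoint_sdiff_right).mono_right (hf1 _)
  have hBt : ∀ n, μ (B n) ≤ t := by
    intro n
    induction n with
    | zero => simp [B]
    | succ n ih => rw [hBadd]; exact hf3 _ ih
  have hU : μ (⋃ n, B n) ≤ t := by
    rw [hmono.measure_iUnion]; exact iSup_le hBt
  refine ⟨⋃ n, B n, Set.iUnion_subset hBA, MeasurableSet.iUnion hBm, ?_⟩
  by_contra hne
  have hlt : μ (⋃ n, B n) < t := lt_of_le_of_ne hU hne
  have hdiff : 0 < μ (A \ ⋃ n, B n) := by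
    rw [measure_sdiff (Set.iUnion_subset hBA) (MeasurableSet.iUnion hBm).nullMeasurableSet
      (measure_ne_top _ _)]
    exact tsub_pos_of_lt (hlt.trans_le ht)
  -- If the exhaustion falls short of `t`, this `C` was a candidate at every stage, so every stage
  -- added at least `μ C / 2`, which is impossible in finite measure.
  obtain ⟨C, hC1, hC2, hC3, hC4⟩ := hμ.exists_small (hA.diff (MeasurableSet.iUnion hBm)) hdiff
    (tsub_pos_of_lt hlt)
  have hCn : ∀ n, μ C ≤ 2 * μ (f (B n)) := by
    intro n
    refine hf4 (B n) C (hC1.trans (Set.sdiff_subset_sdiff_right (Set.subset_iUnion B n))) hC2 ?_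
    calc μ (B n) + μ C ≤ μ (⋃ n, B n) + (t - μ (⋃ n, B n)) :=
          add_le_add (measure_mono (Set.subset_iUnion B n)) hC4
      _ = t := add_tsub_cancel_of_le hU
  have hlin : ∀ n : ℕ, n * (μ C / 2) ≤ μ (B n) := by
    intro n
    induction n with
    | zero => simp
    | succ n ih =>
      rw [hBadd]
      push_cast
      rw [add_mul, one_mul]
      refine add_le_add ih (ENNReal.div_le_of_le_mul' (hCn n))
  obtain ⟨n, hn⟩ := ENNReal.exists_nat_mul_gt (ENNReal.half_pos hC3.ne').ne'
    (ne_top_of_le_ne_top (measure_ne_top μ A) ht)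
  exact absurd (hn.trans_le ((hlin n).trans (hBt n))) (lt_irrefl _)

/-- The fibres are disjoint, so the union of one half of each meets every fibre in exactly its own
half. -/
theorem Nonatomic.exists_halving {μ : Measure Ω} [IsFiniteMeasure μ] (hμ : Nonatomic μ)
    {φ : Ω → ℕ} (hφ : Measurable φ) :
    ∃ H : Set Ω, MeasurableSet H ∧ ∀ k, μ (φ ⁻¹' {k} ∩ H) = μ (φ ⁻¹' {k}) / 2 ∧
      μ (φ ⁻¹' {k} \ H) = μ (φ ⁻¹' {k}) / 2 := by
  have hm : ∀ k, MeasurableSet (φ ⁻¹' {k}) := fun k => hφ (measurableSet_singleton k)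
  choose B hB1 hB2 hB3 using fun k => hμ.exists_measure_eq (hm k)
    (t := μ (φ ⁻¹' {k}) / 2) ENNReal.half_le_self
  have hH : ∀ k, φ ⁻¹' {k} ∩ (⋃ j, B j) = B k := by
    intro k
    ext ω
    simp only [Set.mem_inter_iff, Set.mem_preimage, Set.mem_singleton_iff, Set.mem_iUnion]
    constructor
    · rintro ⟨h, j, hj⟩
      have : φ ω = j := hB1 j hj
      rwa [← h, this]
    · exact fun h => ⟨hB1 k h, k, h⟩
  refine ⟨⋃ k, B k, MeasurableSet.iUnion hB2, fun k => ?_⟩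
  have h1 : μ (φ ⁻¹' {k} ∩ ⋃ j, B j) = μ (φ ⁻¹' {k}) / 2 := by rw [hH, hB3]
  refine ⟨h1, ?_⟩
  rw [← Set.sdiff_inter_self_eq_sdiff, Set.inter_comm, hH,
    measure_sdiff (hB1 k) (hB2 k).nullMeasurableSet (measure_ne_top _ _), hB3]
  exact ENNReal.sub_half (measure_ne_top _ _)

/-- Consistent equidistributed dyadic labels on a nonatomic probability space. -/
theorem Nonatomic.exists_dyadic {μ : Measure Ω} [IsProbabilityMeasure μ] (hμ : Nonatomic μ) :
    ∃ φ : ℕ → Ω → ℕ, (∀ n, Measurable (φ n)) ∧ (∀ n ω, φ n ω < 2 ^ n) ∧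
      (∀ n ω, φ (n + 1) ω = 2 * φ n ω ∨ φ (n + 1) ω = 2 * φ n ω + 1) ∧
      ∀ n, ∀ k < 2 ^ n, μ (φ n ⁻¹' {k}) = (2⁻¹ : ℝ≥0∞) ^ n := by
  classical
  choose! H hH1 hH2 using fun (φ : Ω → ℕ) (hφ : Measurable φ) => hμ.exists_halving hφ
  -- Appends one binary digit to the label, namely 1 on the chosen half of each fibre.
  let step : (Ω → ℕ) → Ω → ℕ := fun φ ω => 2 * φ ω + (H φ).indicator (fun _ => 1) ω
  let φ : ℕ → Ω → ℕ := fun n => step^[n] (fun _ => 0)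
  have hs : ∀ n, φ (n + 1) = step (φ n) := fun n => Function.iterate_succ_apply' _ _ _
  have hφ : ∀ n, Measurable (φ n) := by
    intro n
    induction n with
    | zero => exact measurable_const
    | succ n ih =>
      rw [hs]
      exact (ih.const_mul 2).add (measurable_const.indicator (hH1 _ ih))
  have hcase : ∀ n ω, φ (n + 1) ω = 2 * φ n ω ∨ φ (n + 1) ω = 2 * φ n ω + 1 := by
    intro n ω
    rw [hs]
    by_cases h : ω ∈ H (φ n) <;> simp [step, h]
  refine ⟨φ, hφ, ?_, hcase, ?_⟩
  · intro n ω
    induction n with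
    | zero => simp [φ]
    | succ n ih =>
      rw [pow_succ]
      rcases hcase n ω with h | h <;> omega
  · intro n
    induction n with
    | zero =>
      intro k hk
      obtain rfl : k = 0 := by simpa using hk
      have : φ 0 ⁻¹' {0} = Set.univ := by ext; simp [φ]
      rw [this]; simp
    | succ n ih =>
      intro k hk
      have hj : k / 2 < 2 ^ n := by rw [pow_succ] at hk; omega
      rw [pow_succ, ← ih _ hj, ← ENNReal.div_eq_inv_mul.trans (mul_comm _ _)]
      rcases Nat.mod_two_eq_zero_or_one k with h | h
      · rw [← (hH2 _ (hφ n) (k / 2)).2]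
        congr 1
        ext ω
        rw [hs]
        by_cases hω : ω ∈ H (φ n) <;> simp [step, hω] <;> omega
      · rw [← (hH2 _ (hφ n) (k / 2)).1]
        congr 1
        ext ω
        rw [hs]
        by_cases hω : ω ∈ H (φ n) <;> simp [step, hω] <;> omega

/-- A nonatomic probability space carries a uniformly distributed random variable. -/
theorem Nonatomic.exists_uniform {μ : Measure Ω} [IsProbabilityMeasure μ] (hμ : Nonatomic μ) :
    ∃ U : Ω → unitInterval, Measurable U ∧ μ.map U = volume := by
  obtain ⟨φ, hφ, hlt, hcase, hmass⟩ := hμ.exists_dyadic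
  have hpos : ∀ n : ℕ, (0 : ℝ) < 2 ^ n := fun n => by positivity
  -- The intervals `[φ n ω / 2^n, (φ n ω + 1) / 2^n]` are nested; `U ω` is their common point.
  have hmono : ∀ ω, Monotone fun n => (φ n ω : ℝ) / 2 ^ n := fun ω =>
    monotone_nat_of_le_succ fun n => by
      rw [div_le_div_iff₀ (hpos _) (hpos _), pow_succ]
      rcases hcase n ω with h | h <;> rw [h] <;> push_cast <;> nlinarith [hpos n]
  have hanti : ∀ ω, Antitone fun n => ((φ n ω : ℝ) + 1) / 2 ^ n := fun ω =>
    antitone_nat_of_succ_le fun n => by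
      rw [div_le_div_iff₀ (hpos _) (hpos _), pow_succ]
      rcases hcase n ω with h | h <;> rw [h] <;> push_cast <;> nlinarith [hpos n]
  have hcross : ∀ ω m n, (φ m ω : ℝ) / 2 ^ m ≤ ((φ n ω : ℝ) + 1) / 2 ^ n := by
    intro ω m n
    calc (φ m ω : ℝ) / 2 ^ m ≤ (φ (max m n) ω : ℝ) / 2 ^ (max m n) := hmono ω (le_max_left _ _)
      _ ≤ ((φ (max m n) ω : ℝ) + 1) / 2 ^ (max m n) := by gcongr; linarith
      _ ≤ _ := hanti ω (le_max_right _ _)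
  let U : Ω → ℝ := fun ω => ⨆ n, (φ n ω : ℝ) / 2 ^ n
  have hbdd : ∀ ω, BddAbove (Set.range fun n => (φ n ω : ℝ) / 2 ^ n) := fun ω =>
    ⟨_, by rintro _ ⟨m, rfl⟩; exact hcross ω m 0⟩
  have hUle : ∀ ω n, U ω ≤ ((φ n ω : ℝ) + 1) / 2 ^ n := fun ω n => ciSup_le fun m => hcross ω m n
  have hleU : ∀ ω n, (φ n ω : ℝ) / 2 ^ n ≤ U ω := fun ω n => le_ciSup (hbdd ω) n
  have hUm : Measurable U := Measurable.iSup fun n =>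
    ((measurable_from_top (f := fun k : ℕ => (k : ℝ))).comp (hφ n)).div_const _
  have hU01 : ∀ ω, U ω ∈ unitInterval := by
    intro ω
    refine ⟨le_trans (by positivity) (hleU ω 0), ?_⟩
    have h0 := hlt 0 ω
    have := hUle ω 0
    have h0' : φ 0 ω = 0 := by simpa using h0
    simpa [h0'] using this
  have hcum : ∀ n k, k ≤ 2 ^ n → μ.real {ω | φ n ω < k} = k / 2 ^ n := by
    intro n k
    induction k with
    | zero => simp
    | succ k ih =>
      intro hk
      have hset : {ω | φ n ω < k + 1} = {ω | φ n ω < k} ∪ φ n ⁻¹' {k} := by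
        ext ω; simp; omega
      rw [hset, measureReal_union _ (hφ n (measurableSet_singleton k)), ih (by omega),
        measureReal_def (s := φ n ⁻¹' {k}), hmass n k (by omega)]
      · simp; field_simp
      · rw [Set.disjoint_left]
        intro ω h1 h2
        simp at h1 h2
        omega
  -- Both sides lie between `k / 2^n` and `(k + 1) / 2^n` with `k = ⌊t 2^n⌋`. The condition `t < 1`
  -- ensures `k + 1 ≤ 2^n`; the endpoint 1 is treated separately.
  have hcdf : ∀ t : ℝ, 0 ≤ t → t < 1 → μ.real {ω | U ω ≤ t} = t := by
    intro t ht0 ht1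
    have hb : ∀ n : ℕ, |μ.real {ω | U ω ≤ t} - t| ≤ (1 / 2 : ℝ) ^ n := by
      intro n
      set k := ⌊t * 2 ^ n⌋₊ with hk
      have hk1 : (k : ℝ) ≤ t * 2 ^ n := Nat.floor_le (by positivity)
      have hk2 : t * 2 ^ n < k + 1 := Nat.lt_floor_add_one _
      have hk3 : k < 2 ^ n := by
        rw [← Nat.cast_lt (α := ℝ)]
        push_cast
        nlinarith [hpos n]
      have h1 : μ.real {ω | φ n ω < k} ≤ μ.real {ω | U ω ≤ t} := by
        refine measureReal_mono fun ω hω => (hUle ω n).trans ?_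
        rw [div_le_iff₀ (hpos n)]
        refine le_trans ?_ hk1
        exact_mod_cast Nat.succ_le_of_lt hω
      have h2 : μ.real {ω | U ω ≤ t} ≤ μ.real {ω | φ n ω < k + 1} := by
        refine measureReal_mono fun ω hω => Nat.lt_succ_of_le (Nat.le_floor ?_)
        rw [← div_le_iff₀ (hpos n)]
        exact (hleU ω n).trans hω
      rw [hcum n k hk3.le] at h1
      rw [hcum n (k + 1) hk3, div_eq_mul_inv] at h2
      rw [div_eq_mul_inv] at h1
      have hinv : (1 / 2 : ℝ) ^ n = (2 ^ n)⁻¹ := by simp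
      have hmul : (2 ^ n : ℝ) * (2 ^ n)⁻¹ = 1 := mul_inv_cancel₀ (hpos n).ne'
      have hip : (0 : ℝ) < (2 ^ n)⁻¹ := inv_pos.2 (hpos n)
      push_cast at h2
      rw [hinv, abs_le]
      constructor <;> nlinarith
    have hz : |μ.real {ω | U ω ≤ t} - t| ≤ 0 :=
      ge_of_tendsto' (tendsto_pow_atTop_nhds_zero_of_lt_one (by norm_num) (by norm_num)) hb
    linarith [abs_nonpos_iff.1 hz]
  have hVm : Measurable fun ω => (⟨U ω, hU01 ω⟩ : unitInterval) := hUm.subtype_mk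
  refine ⟨fun ω => ⟨U ω, hU01 ω⟩, hVm, ?_⟩
  have : IsProbabilityMeasure (μ.map fun ω => (⟨U ω, hU01 ω⟩ : unitInterval)) :=
    Measure.isProbabilityMeasure_map hVm.aemeasurable
  refine Measure.ext_of_Iic _ _ fun x => ?_
  rw [Measure.map_apply hVm measurableSet_Iic, unitInterval.volume_Iic]
  rcases eq_or_lt_of_le x.2.2 with hx | hx
  · have : (fun ω => (⟨U ω, hU01 ω⟩ : unitInterval)) ⁻¹' Set.Iic x = Set.univ := by
      ext ω
      simp only [Set.mem_preimage, Set.mem_Iic, Set.mem_univ, iff_true]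
      exact Subtype.coe_le_coe.1 (by rw [hx]; exact (hU01 ω).2)
    rw [this, hx]; simp
  · rw [← hcdf x x.2.1 hx, ofReal_measureReal]
    rfl

/-- A nonatomic probability space carries an i.i.d. sequence of any given law. -/
theorem Nonatomic.exists_iid {μ : Measure Ω} [IsProbabilityMeasure μ] (hμ : Nonatomic μ)
    (ν : Measure ℝ) [IsProbabilityMeasure ν] :
    ∃ Y : ℕ → Ω → ℝ, (∀ i, Measurable (Y i)) ∧ (∀ i, μ.map (Y i) = ν) ∧ iIndepFun Y μ := by
  obtain ⟨U, hU, hUmap⟩ := hμ.exists_uniform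
  -- The product law on the standard Borel space `ℕ → ℝ` is an image of Lebesgue measure on the unit
  -- interval, so one uniform variable yields the whole sequence.
  obtain ⟨f, hf, hfmap⟩ := (Measure.infinitePi fun _ : ℕ => ν).exists_measurable_map_eq
  have hY : ∀ i : ℕ, Measurable fun ω => f (U ω) i := fun i =>
    (measurable_pi_apply i).comp (hf.comp hU)
  have hmap : μ.map (fun ω => f (U ω)) = Measure.infinitePi fun _ : ℕ => ν := by
    rw [← hfmap, ← hUmap, Measure.map_map hf hU]; rfl
  have hmapi : ∀ i, μ.map (fun ω => f (U ω) i) = ν := by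
    intro i
    rw [← Measure.infinitePi_map_eval (fun _ : ℕ => ν) i, ← hmap,
      Measure.map_map (f := fun ω => f (U ω)) (measurable_pi_apply i) (hf.comp hU)]
    rfl
  refine ⟨fun i ω => f (U ω) i, hY, hmapi, ?_⟩
  rw [iIndepFun_iff_map_fun_eq_infinitePi_map hY]
  simp_rw [hmapi]
  exact hmap

/-! ### Resampling on a set and the law of large numbers. -/

/-- Resampling a random variable on a set by one with the same conditional law preserves the
law. -/
theorem identDistrib_piecewise {P : Measure Ω} [IsFiniteMeasure P] {B : Set Ω}
    [DecidablePred (· ∈ B)] (hB : MeasurableSet B) (hB0 : P B ≠ 0) {X Y : Ω → ℝ}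
    (hX : Measurable X) (hY : Measurable Y)
    (h : P[|B].map Y = P[|B].map X) : IdentDistrib (B.piecewise Y X) X P P := by
  refine ⟨(hY.piecewise hB hX).aemeasurable, hX.aemeasurable, ?_⟩
  ext s hs
  rw [Measure.map_apply (hY.piecewise hB hX) hs, Measure.map_apply hX hs,
    ← measure_inter_add_sdiff _ hB, ← measure_inter_add_sdiff (X ⁻¹' s) hB]
  have h1 : P (B.piecewise Y X ⁻¹' s ∩ B) = P (X ⁻¹' s ∩ B) := by
    have := congrArg (fun m => m s) h
    simp only [Measure.map_apply hY hs, Measure.map_apply hX hs, cond_apply hB] at this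
    rw [ENNReal.mul_right_inj (by simp) (by simpa using hB0)] at this
    rw [Set.inter_comm, Set.inter_comm (X ⁻¹' s), ← this]
    congr 1
    ext ω
    by_cases hω : ω ∈ B <;> simp [hω]
  have h2 : B.piecewise Y X ⁻¹' s \ B = X ⁻¹' s \ B := by
    ext ω
    by_cases hω : ω ∈ B <;> simp [hω]
  rw [h1, h2]

theorem restrict_absolutelyContinuous_cond (P : Measure Ω) [IsFiniteMeasure P] (B : Set Ω) :
    P.restrict B ≪ P[|B] := by
  intro s hs
  rw [ProbabilityTheory.cond, Measure.smul_apply, smul_eq_mul, mul_eq_zero] at hs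
  exact hs.resolve_left (ENNReal.inv_ne_zero.2 (measure_ne_top _ _))

/-- On a set of positive measure, the conditional mean is the almost sure limit of averages of
resampled copies. -/
theorem Nonatomic.exists_resampling {P : Measure Ω} [IsProbabilityMeasure P] (hP : Nonatomic P)
    {B : Set Ω} (hB : MeasurableSet B) (hB0 : P B ≠ 0) {X : Ω → ℝ} (hX : Measurable X)
    (hXi : Integrable X P) :
    ∃ Y : ℕ → Ω → ℝ, (∀ i, Measurable (Y i)) ∧ (∀ i, P[|B].map (Y i) = P[|B].map X) ∧
      ∀ᵐ ω ∂P, ω ∈ B → Tendsto (fun n : ℕ => (n : ℝ)⁻¹ * ∑ i ∈ Finset.range n, Y i ω) atTop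
        (𝓝 (⨍ x in B, X x ∂P)) := by
  have : IsProbabilityMeasure P[|B] := cond_isProbabilityMeasure hB0
  have : IsProbabilityMeasure (P[|B].map X) := Measure.isProbabilityMeasure_map hX.aemeasurable
  obtain ⟨Y, hY, hYmap, hind⟩ := (hP.cond hB hB0).exists_iid (P[|B].map X)
  have hid : ∀ i, IdentDistrib (Y i) X P[|B] P[|B] := fun i =>
    ⟨(hY i).aemeasurable, hX.aemeasurable, hYmap i⟩
  have hXc : Integrable X P[|B] :=
    hXi.restrict.smul_measure (ENNReal.inv_ne_top.2 hB0)
  refine ⟨Y, hY, hYmap, ?_⟩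
  have hlln := strong_law_ae_real Y ((hid 0).integrable_iff.2 hXc)
    (fun i j hij => hind.indepFun hij) (fun i => (hid i).trans (hid 0).symm)
  have hmean : (∫ ω, Y 0 ω ∂P[|B]) = ⨍ x in B, X x ∂P := by
    rw [(hid 0).integral_eq, setAverage_eq']; rfl
  rw [hmean] at hlln
  rw [← ae_restrict_iff' hB]
  filter_upwards [(restrict_absolutelyContinuous_cond P B).ae_le hlln] with ω hω
  simpa only [div_eq_inv_mul] using hω

/-! ### The domain, dominated Fatou, and averaging over one set. -/

/-- A quasiconvex law-invariant functional with the Fatou property on an admissible domain. -/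
structure LawInvariantRisk (P : Measure Ω) (D : Set (Ω →₁[P] ℝ)) (ρ : (Ω →₁[P] ℝ) → EReal) :
    Prop where
  convex : Convex ℝ D
  add_mem : ∀ X ∈ D, ∀ Y ∈ D, X + Y ∈ D
  bounded_mem : ∀ X : Ω →₁[P] ℝ, MemLp (X : Ω → ℝ) ∞ P → X ∈ D
  indicator_mem : ∀ X ∈ D, ∀ (A : Set Ω) (hA : MeasurableSet A), mulIndicator X A hA ∈ D
  quasiconvex : RiskQuasiconvexOn D ρ
  law : LawInvariantOn D ρ
  fatou : FatouOn D ρ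

theorem mem_of_ae_abs_le {P : Measure Ω} {D : Set (Ω →₁[P] ℝ)} {ρ : (Ω →₁[P] ℝ) → EReal}
    (h : LawInvariantRisk P D ρ) {Z : Ω →₁[P] ℝ} {c : ℝ} (hZ : ∀ᵐ ω ∂P, |Z ω| ≤ c) : Z ∈ D :=
  h.bounded_mem Z (memLp_top_of_bound (Lp.aestronglyMeasurable Z) c hZ)

theorem mulIndicator_coeFn {P : Measure Ω} (X : Ω →₁[P] ℝ) (A : Set Ω) (hA : MeasurableSet A) :
    mulIndicator X A hA =ᵐ[P] A.indicator (X : Ω → ℝ) :=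
  Integrable.coeFn_toL1 _

variable {P : Measure Ω} {D : Set (Ω →₁[P] ℝ)} {ρ : (Ω →₁[P] ℝ) → EReal}

/-- Changing an element of the domain to a bounded one on a measurable set stays in the domain. -/
theorem LawInvariantRisk.mem_of_eq_off (h : LawInvariantRisk P D ρ) {X Z : Ω →₁[P] ℝ} (hX : X ∈ D)
    {B : Set Ω} (hB : MeasurableSet B) {c : ℝ} (hin : ∀ᵐ ω ∂P, ω ∈ B → |Z ω| ≤ c)
    (hout : ∀ᵐ ω ∂P, ω ∉ B → Z ω = X ω) : Z ∈ D := by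
  have hsplit : Z = mulIndicator X Bᶜ hB.compl + mulIndicator Z B hB := by
    refine Lp.ext ?_
    filter_upwards [hout, Lp.coeFn_add (mulIndicator X Bᶜ hB.compl) (mulIndicator Z B hB),
      mulIndicator_coeFn X Bᶜ hB.compl, mulIndicator_coeFn Z B hB] with ω h1 h2 h3 h4
    rw [h2, Pi.add_apply, h3, h4]
    by_cases hω : ω ∈ B
    · simp [hω]
    · simp [hω, h1 hω]
  rw [hsplit]
  refine h.add_mem _ (h.indicator_mem X hX _ _) _ (mem_of_ae_abs_le h (c := |c|) ?_)
  filter_upwards [hin, mulIndicator_coeFn Z B hB] with ω h1 h2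
  rw [h2]
  by_cases hω : ω ∈ B
  · simpa [hω] using (h1 hω).trans (le_abs_self c)
  · simp [hω]

/-- The Fatou property under domination by `|X| + c` with `X` in the domain. -/
theorem LawInvariantRisk.le_liminf [IsFiniteMeasure P] (h : LawInvariantRisk P D ρ)
    {X : Ω →₁[P] ℝ} (hX : X ∈ D) {c : ℝ} {Y : ℕ → (Ω →₁[P] ℝ)} {Y₀ : Ω →₁[P] ℝ}
    (hY : ∀ n, Y n ∈ D) (hY₀ : Y₀ ∈ D)
    (hlim : ∀ᵐ ω ∂P, Tendsto (fun n => Y n ω) atTop (𝓝 (Y₀ ω)))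
    (hdom : ∀ n, ∀ᵐ ω ∂P, |Y n ω| ≤ |X ω| + c) :
    ρ Y₀ ≤ liminf (fun n => ρ (Y n)) atTop := by
  have hdom' : ∀ᵐ ω ∂P, ∀ n, |Y n ω| ≤ |X ω| + c := ae_all_iff.2 hdom
  have hlub : ∀ᵐ ω ∂P, IsLUB (Set.range fun n => |Y n ω|) (⨆ n, |Y n ω|) := by
    filter_upwards [hdom'] with ω hω
    exact isLUB_ciSup ⟨_, by rintro _ ⟨n, rfl⟩; exact hω n⟩
  have habs : ∀ᵐ ω ∂P, |(⨆ n, |Y n ω| : ℝ)| ≤ |X ω| + c := by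
    filter_upwards [hdom'] with ω hω
    rw [abs_of_nonneg (Real.iSup_nonneg fun n => abs_nonneg _)]
    exact ciSup_le hω
  have hmeas : Measurable fun ω => ⨆ n, |Y n ω| :=
    Measurable.iSup fun n => (Lp.stronglyMeasurable (Y n)).measurable.abs
  have hint : Integrable (fun ω => ⨆ n, |Y n ω|) P :=
    ((L1.integrable_coeFn X).abs.add (integrable_const c)).mono' hmeas.aestronglyMeasurable habs
  refine h.fatou Y Y₀ hY hY₀ hlim ⟨hint.toL1 _, ?_, ?_⟩
  · have h1 : Lp.const 1 P (1 : ℝ) ∈ D := by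
      refine mem_of_ae_abs_le h (c := 1) ?_
      filter_upwards [Lp.coeFn_const 1 P (1 : ℝ)] with ω hω
      rw [hω]; simp
    -- The coefficient is `|c|` because `c` may be negative, while the ideal requires nonnegative
    -- weights.
    refine ⟨2, ![X, Lp.const 1 P (1 : ℝ)], ![1, |c|], ?_, ?_, ?_⟩
    · intro i; fin_cases i <;> simp [hX, h1]
    · intro i; fin_cases i <;> simp
    · rw [← Lp.coeFn_le]
      simp only [Fin.sum_univ_two, Matrix.cons_val_zero, Matrix.cons_val_one, one_smul]
      filter_upwards [Lp.coeFn_abs (hint.toL1 _), hint.coeFn_toL1, habs, Lp.coeFn_abs X,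
        Lp.coeFn_add |X| (|c| • |Lp.const 1 P (1 : ℝ)|), Lp.coeFn_smul |c| |Lp.const 1 P (1 : ℝ)|,
        Lp.coeFn_abs (Lp.const 1 P (1 : ℝ)), Lp.coeFn_const 1 P (1 : ℝ)]
        with ω e1 e2 e3 e4 e5 e6 e7 e8
      rw [e1, e2, e5, Pi.add_apply, e4, e6, Pi.smul_apply, e7, e8]
      simpa using e3.trans (by linarith [le_abs_self c])
  · filter_upwards [hlub, hint.coeFn_toL1] with ω h1 h2
    rwa [h2]

theorem LawInvariantRisk.convex_sublevel (h : LawInvariantRisk P D ρ) (r : EReal) :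
    Convex ℝ {X | X ∈ D ∧ ρ X ≤ r} := by
  rw [convex_iff_forall_pos]
  intro X hX Y hY a b ha hb hab
  have hmem : a • X + b • Y ∈ D := h.convex hX.1 hY.1 ha.le hb.le hab
  obtain rfl : b = 1 - a := by linarith
  exact ⟨hmem, (h.quasiconvex X hX.1 Y hY.1 a ha (by linarith) hmem).trans (max_le hX.2 hY.2)⟩

/-- Replacing `X` by its mean on a set where it is bounded decreases `ρ`. -/
theorem LawInvariantRisk.average_le [IsProbabilityMeasure P] (hP : Nonatomic P)
    (h : LawInvariantRisk P D ρ) {X Z : Ω →₁[P] ℝ} (hX : X ∈ D) {B : Set Ω}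
    (hB : MeasurableSet B) {c : ℝ} (hc : ∀ᵐ ω ∂P, ω ∈ B → |X ω| ≤ c)
    (hin : ∀ᵐ ω ∂P, ω ∈ B → Z ω = ⨍ x in B, X x ∂P)
    (hout : ∀ᵐ ω ∂P, ω ∉ B → Z ω = X ω) : Z ∈ D ∧ ρ Z ≤ ρ X := by
  classical
  by_cases hB0 : P B = 0
  · have : Z = X := by
      refine Lp.ext ?_
      filter_upwards [hout, measure_eq_zero_iff_ae_notMem.1 hB0] with ω h1 h2 using h1 h2
    rw [this]; exact ⟨hX, le_rfl⟩
  have hXm : Measurable (X : Ω → ℝ) := (Lp.stronglyMeasurable X).measurable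
  obtain ⟨Y, hY, hYmap, hlim⟩ := hP.exists_resampling hB hB0 hXm (L1.integrable_coeFn X)
  have hid := fun i => identDistrib_piecewise hB hB0 hXm (hY i) (hYmap i)
  have hint : ∀ i, Integrable (B.piecewise (Y i) X) P := fun i =>
    (hid i).integrable_iff.2 (L1.integrable_coeFn X)
  have hYc : ∀ i, ∀ᵐ ω ∂P, ω ∈ B → |Y i ω| ≤ c := by
    intro i
    rw [← ae_restrict_iff' hB]
    have hac : P[|B] ≪ P.restrict B := Measure.smul_absolutelyContinuous
    have h1 : ∀ᵐ ω ∂P[|B], |X ω| ≤ c := hac.ae_le ((ae_restrict_iff' hB).2 hc)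
    have hid' : IdentDistrib (Y i) X P[|B] P[|B] :=
      ⟨(hY i).aemeasurable, hXm.aemeasurable, hYmap i⟩
    exact (restrict_absolutelyContinuous_cond P B).ae_le (hid'.symm.ae_snd (p := fun x => |x| ≤ c)
      (measurableSet_le measurable_id.abs measurable_const) h1)
  let V : ℕ → (Ω →₁[P] ℝ) := fun i => (hint i).toL1 _
  have hV : ∀ i, V i =ᵐ[P] B.piecewise (Y i) X := fun i => (hint i).coeFn_toL1
  have hVmem : ∀ i, V i ∈ D ∧ ρ (V i) ≤ ρ X := by
    intro i
    have hm : V i ∈ D := by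
      refine h.mem_of_eq_off hX hB (c := c) ?_ ?_
      · filter_upwards [hV i, hYc i] with ω h1 h2 hω
        rw [h1]; simpa [hω] using h2 hω
      · filter_upwards [hV i] with ω h1 hω
        rw [h1]; simp [hω]
    exact ⟨hm, (h.law _ hm X hX ((IdentDistrib.of_ae_eq
      (Lp.aestronglyMeasurable (V i)).aemeasurable (hV i)).trans (hid i))).le⟩
  have hVc : ∀ᵐ ω ∂P, ∀ i, |V i ω| ≤ |X ω| + |c| := by
    rw [ae_all_iff]
    intro i
    filter_upwards [hV i, hYc i] with ω h1 h2
    rw [h1]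
    by_cases hω : ω ∈ B
    · simp only [hω, Set.piecewise_eq_of_mem]
      linarith [h2 hω, abs_nonneg (X ω), le_abs_self c]
    · simp [hω]
  -- Averaging `n + 1` copies makes every `W n`, including `W 0`, a genuine convex combination.
  let W : ℕ → (Ω →₁[P] ℝ) := fun n => ∑ i ∈ Finset.range (n + 1), ((n + 1 : ℕ) : ℝ)⁻¹ • V i
  have hWmem : ∀ n, W n ∈ D ∧ ρ (W n) ≤ ρ X := fun n =>
    (h.convex_sublevel (ρ X)).sum_mem (fun _ _ => by positivity)
      (by
        rw [Finset.sum_const, Finset.card_range, nsmul_eq_mul]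
        exact mul_inv_cancel₀ (by positivity)) fun i _ => hVmem i
  have hWcoe : ∀ n, ∀ᵐ ω ∂P, W n ω =
      ((n + 1 : ℕ) : ℝ)⁻¹ * ∑ i ∈ Finset.range (n + 1), V i ω := by
    intro n
    have hs : ∀ᵐ ω ∂P, ∀ i, (((n + 1 : ℕ) : ℝ)⁻¹ • V i : Ω →₁[P] ℝ) ω
        = ((n + 1 : ℕ) : ℝ)⁻¹ * V i ω := by
      rw [ae_all_iff]
      intro i
      filter_upwards [Lp.coeFn_smul ((n + 1 : ℕ) : ℝ)⁻¹ (V i)] with ω hω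
      rw [hω]; rfl
    filter_upwards [Lp.coeFn_finsetSum (Finset.range (n + 1)) fun i => ((n + 1 : ℕ) : ℝ)⁻¹ • V i, hs]
      with ω h1 h2
    simp only [W, h1, Finset.sum_apply, h2, Finset.mul_sum]
  have hZX : Z ∈ D := h.mem_of_eq_off hX hB (c := |⨍ x in B, X x ∂P|)
    (hin.mono fun ω hω hωB => by rw [hω hωB]) hout
  refine ⟨hZX, ?_⟩
  refine (h.le_liminf hX (c := |c|) (fun n => (hWmem n).1) hZX ?_ fun n => ?_).trans
    (liminf_le_of_frequently_le' (Frequently.of_forall fun n => (hWmem n).2))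
  · filter_upwards [ae_all_iff.2 hWcoe, ae_all_iff.2 hV, hlim, hin, hout] with ω h1 h2 h3 h4 h5
    simp only [h1, h2]
    by_cases hω : ω ∈ B
    · simp only [hω, Set.piecewise_eq_of_mem, h4]
      exact (h3 hω).comp (tendsto_add_atTop_nat 1)
    · have he : ∀ n : ℕ, ((n + 1 : ℕ) : ℝ)⁻¹ *
          ∑ i ∈ Finset.range (n + 1), B.piecewise (Y i) X ω = Z ω := by
        intro n
        simp only [hω, not_false_eq_true, Set.piecewise_eq_of_notMem, h5, Finset.sum_const,
          Finset.card_range, nsmul_eq_mul]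
        exact inv_mul_cancel_left₀ (by positivity) _
      simp only [he]
      exact tendsto_const_nhds
  · filter_upwards [hWcoe n, hVc] with ω h1 h2
    rw [h1, abs_mul, abs_inv, Nat.abs_cast, inv_mul_le_iff₀ (by positivity)]
    calc |∑ i ∈ Finset.range (n + 1), V i ω| ≤ ∑ i ∈ Finset.range (n + 1), |V i ω| :=
          Finset.abs_sum_le_sum_abs _ _
      _ ≤ ∑ i ∈ Finset.range (n + 1), (|X ω| + |c|) := Finset.sum_le_sum fun i _ => h2 i
      _ = _ := by simp [mul_add]

/-! ### Conditional expectation given a finite partition. -/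

theorem FinPartition.exists_mem (π : FinPartition P) (ω : Ω) : ∃ A ∈ π.parts, ω ∈ A := by
  have : ω ∈ ⋃₀ (π.parts : Set (Set Ω)) := by rw [π.sUnion_eq]; trivial
  simpa using this

theorem FinPartition.eq_of_mem (π : FinPartition P) {A B : Set Ω} (hA : A ∈ π.parts)
    (hB : B ∈ π.parts) {ω : Ω} (hωA : ω ∈ A) (hωB : ω ∈ B) : A = B := by
  by_contra hne
  exact Set.disjoint_left.1 (π.pairwiseDisjoint hA hB hne) hωA hωB

/-- Cells are atoms of `σ(π)`: the property holds for the generators and survives complements and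
countable unions. -/
theorem FinPartition.subset_or_disjoint (π : FinPartition P) {s : Set Ω}
    (hs : MeasurableSet[π.sigma] s) : ∀ A ∈ π.parts, A ⊆ s ∨ Disjoint A s := by
  induction s, hs using MeasurableSpace.generateFrom_induction with
  | hC t ht _ =>
    intro A hA
    by_cases h : A = t
    · exact Or.inl h.subset
    · exact Or.inr (π.pairwiseDisjoint hA ht h)
  | empty => exact fun A _ => Or.inr (Set.disjoint_empty A)
  | compl t _ ih =>
    intro A hA
    rcases ih A hA with h | h
    · exact Or.inr (Set.disjoint_compl_right_iff_subset.2 h)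
    · exact Or.inl (Set.subset_compl_iff_disjoint_right.2 h)
  | iUnion s _ ih =>
    intro A hA
    by_cases h : ∃ n, A ⊆ s n
    · obtain ⟨n, hn⟩ := h
      exact Or.inl (hn.trans (Set.subset_iUnion s n))
    · push Not at h
      exact Or.inr (Set.disjoint_iUnion_right.2 fun n => (ih n A hA).resolve_left (h n))

/-- The conditional expectation given a finite partition is the mean over the cell. -/
theorem condE_ae_eq [IsFiniteMeasure P] (π : FinPartition P) (X : Ω →₁[P] ℝ) :
    ∀ᵐ ω ∂P, ∀ A ∈ π.parts, ω ∈ A → condE π X ω = ⨍ x in A, X x ∂P := by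
  classical
  let g : Ω → ℝ := fun ω => ∑ A ∈ π.parts, A.indicator (fun _ => ⨍ x in A, X x ∂P) ω
  have hg : ∀ A ∈ π.parts, ∀ ω ∈ A, g ω = ⨍ x in A, X x ∂P := by
    intro A hA ω hω
    simp only [g]
    rw [Finset.sum_eq_single_of_mem A hA, Set.indicator_of_mem hω]
    intro B hB hne
    exact Set.indicator_of_notMem (fun hωB => hne (π.eq_of_mem hB hA hωB hω)) _
  have hgsm : StronglyMeasurable[π.sigma] g :=
    Finset.stronglyMeasurable_fun_sum _ fun A hA =>
      (@stronglyMeasurable_const _ _ π.sigma _ _).indicator (MeasurableSpace.measurableSet_generateFrom hA)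
  have hgint : Integrable g P := integrable_finsetSum _ fun A hA =>
    (integrable_const _).indicator (π.measurableSet_of_mem A hA)
  have hX := L1.integrable_coeFn X
  have hsum : ∀ (f : Ω → ℝ), Integrable f P → ∀ s, MeasurableSet s →
      ∫ x in s, f x ∂P = ∑ A ∈ π.parts, ∫ x in s ∩ A, f x ∂P := by
    intro f hf s hs
    rw [← integral_biUnion_finset π.parts (fun A hA => hs.inter (π.measurableSet_of_mem A hA))
      (fun A hA B hB hne => (π.pairwiseDisjoint hA hB hne).mono Set.inter_subset_right
        Set.inter_subset_right) (fun A _ => hf.integrableOn)]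
    congr 2
    ext ω
    simp only [Set.mem_iUnion, Set.mem_inter_iff, exists_prop]
    obtain ⟨A, hA, hωA⟩ := π.exists_mem ω
    exact ⟨fun h => ⟨A, hA, h, hωA⟩, fun ⟨_, _, h, _⟩ => h⟩
  have hcond : g =ᵐ[P] P[(X : Ω → ℝ)|π.sigma] := by
    refine ae_eq_condExp_of_forall_setIntegral_eq π.sigma_le hX (fun _ _ _ => hgint.integrableOn)
      (fun s hs _ => ?_) hgsm.aestronglyMeasurable
    rw [hsum g hgint s (π.sigma_le s hs), hsum _ hX s (π.sigma_le s hs)]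
    refine Finset.sum_congr rfl fun A hA => ?_
    rcases π.subset_or_disjoint hs A hA with h | h
    · rw [Set.inter_eq_right.2 h, setIntegral_congr_fun (π.measurableSet_of_mem A hA) (hg A hA),
        setIntegral_const, setAverage_eq, smul_eq_mul, smul_eq_mul, mul_inv_cancel_left₀]
      exact (measureReal_ne_zero_iff (measure_ne_top _ _)).2 (π.measure_ne_zero A hA)
    · rw [Set.inter_comm, h.inter_eq]; simp
  filter_upwards [hcond, Integrable.coeFn_toL1
    (integrable_condExp (m := π.sigma) (μ := P) (f := (X : Ω → ℝ)))] with ω h1 h2 A hA hω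
  rw [condE, h2, ← h1, hg A hA ω hω]

theorem condE_bound [IsFiniteMeasure P] (π : FinPartition P) (X : Ω →₁[P] ℝ) :
    ∃ c : ℝ, ∀ᵐ ω ∂P, |condE π X ω| ≤ c := by
  refine ⟨∑ A ∈ π.parts, |⨍ x in A, X x ∂P|, ?_⟩
  filter_upwards [condE_ae_eq π X] with ω hω
  obtain ⟨A, hA, hωA⟩ := π.exists_mem ω
  rw [hω A hA hωA]
  exact Finset.single_le_sum (f := fun A => |⨍ x in A, X x ∂P|) (fun _ _ => abs_nonneg _) hA

theorem LawInvariantRisk.condE_mem [IsFiniteMeasure P] (h : LawInvariantRisk P D ρ)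
    (π : FinPartition P) (X : Ω →₁[P] ℝ) : condE π X ∈ D := by
  obtain ⟨c, hc⟩ := condE_bound π X
  exact mem_of_ae_abs_le h hc

theorem ae_measure_fiber_ne_zero {α : Type*} (f : SimpleFunc Ω α) :
    ∀ᵐ ω ∂P, P (f ⁻¹' {f ω}) ≠ 0 := by
  have : ∀ᵐ ω ∂P, ∀ a ∈ f.range, P (f ⁻¹' {a}) = 0 → f ω ≠ a := by
    rw [Filter.eventually_all_finset]
    intro a _
    by_cases h0 : P (f ⁻¹' {a}) = 0
    · filter_upwards [measure_eq_zero_iff_ae_notMem.1 h0] with ω hω _ using hω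
    · exact Eventually.of_forall fun _ h => absurd h h0
  filter_upwards [this] with ω hω h0
  exact hω (f ω) (f.mem_range_self ω) h0 rfl

/-- A measurable map with finitely many values yields a partition with members of positive
probability which has the same cell averages. -/
theorem exists_finPartition_of_simpleFunc [IsProbabilityMeasure P] {α : Type*}
    (f : SimpleFunc Ω α) : ∃ π : FinPartition P, ∀ X : Ω →₁[P] ℝ,
      ∀ᵐ ω ∂P, condE π X ω = ⨍ x in f ⁻¹' {f ω}, X x ∂P := by
  classical
  have hN := ae_measure_fiber_ne_zero (P := P) f
  obtain ⟨ω₀, hω₀⟩ := hN.exists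
  -- Null fibres are absorbed into the non-null fibre of `ω₀`, which changes no cell average.
  let g : SimpleFunc Ω α := f.map fun a => if P (f ⁻¹' {a}) = 0 then f ω₀ else a
  have hgf : ∀ ω, P (f ⁻¹' {f ω}) ≠ 0 → g ω = f ω := fun ω h => by simp [g, h]
  have hpos : ∀ ω, P (g ⁻¹' {g ω}) ≠ 0 := by
    intro ω
    have hne : P (f ⁻¹' {g ω}) ≠ 0 := by
      by_cases h : P (f ⁻¹' {f ω}) = 0
      · simpa [g, h] using hω₀
      · rwa [hgf ω h]
    refine fun h0 => hne (measure_mono_null (fun ω' hω' => ?_) h0)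
    have e : f ω' = g ω := hω'
    show g ω' = g ω
    rw [hgf ω' (by rwa [e]), e]
  let π : FinPartition P :=
    { parts := g.range.image fun a => g ⁻¹' {a}
      measurableSet_of_mem := by
        intro A hA
        obtain ⟨a, -, rfl⟩ := Finset.mem_image.1 hA
        exact g.measurableSet_fiber a
      measure_ne_zero := by
        intro A hA
        obtain ⟨a, ha, rfl⟩ := Finset.mem_image.1 hA
        obtain ⟨ω, rfl⟩ := SimpleFunc.mem_range.1 ha
        exact hpos ω
      pairwiseDisjoint := by
        intro A hA B hB hne
        obtain ⟨a, -, rfl⟩ := Finset.mem_image.1 (Finset.mem_coe.1 hA)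
        obtain ⟨b, -, rfl⟩ := Finset.mem_image.1 (Finset.mem_coe.1 hB)
        refine Disjoint.preimage _ (Set.disjoint_singleton.2 fun hab => hne ?_)
        rw [hab]
      sUnion_eq := by
        refine Set.eq_univ_of_forall fun ω => ⟨g ⁻¹' {g ω}, ?_, rfl⟩
        exact Finset.mem_coe.2 (Finset.mem_image_of_mem _ (g.mem_range_self ω)) }
  refine ⟨π, fun X => ?_⟩
  filter_upwards [condE_ae_eq π X, hN] with ω h1 h2
  rw [h1 (g ⁻¹' {g ω}) (Finset.mem_image_of_mem _ (g.mem_range_self ω)) rfl, hgf ω h2]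
  refine setAverage_congr ?_
  filter_upwards [hN] with ω' h3
  refine propext ?_
  show g ω' = f ω ↔ f ω' = f ω
  rw [hgf ω' h3]

/-! ### Dilatation monotonicity on the domain. -/

/-- Replacing `X` by its means on finitely many disjoint sets where it is bounded decreases
`ρ`. -/
theorem LawInvariantRisk.exists_average_finset [IsProbabilityMeasure P] (hP : Nonatomic P)
    (h : LawInvariantRisk P D ρ) {X : Ω →₁[P] ℝ} (hX : X ∈ D) {c : ℝ} (S : Finset (Set Ω)) :
    (∀ B ∈ S, MeasurableSet B) → (S : Set (Set Ω)).PairwiseDisjoint id →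
    (∀ B ∈ S, ∀ ω ∈ B, |X ω| ≤ c) →
    ∃ Z ∈ D, ρ Z ≤ ρ X ∧ (∀ B ∈ S, ∀ᵐ ω ∂P, ω ∈ B → Z ω = ⨍ x in B, X x ∂P) ∧
      ∀ᵐ ω ∂P, (∀ B ∈ S, ω ∉ B) → Z ω = X ω := by
  classical
  induction S using Finset.induction_on with
  | empty => exact fun _ _ _ => ⟨X, hX, le_rfl, by simp, by simp⟩
  | insert B S hBS ih =>
    intro hm hd hc
    have hBm := hm B (Finset.mem_insert_self _ _)
    have hdB : ∀ A ∈ S, Disjoint A B := fun A hA =>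
      hd (Finset.mem_insert_of_mem hA) (Finset.mem_insert_self _ _)
        (fun e => hBS (e ▸ hA))
    obtain ⟨Z, hZ, hZX, hZin, hZout⟩ := ih (fun A hA => hm A (Finset.mem_insert_of_mem hA))
      (hd.subset (by simp)) fun A hA => hc A (Finset.mem_insert_of_mem hA)
    -- Earlier averaging took place on sets disjoint from `B`, so bound and mean on `B` are still
    -- those of `X`.
    have hZB : ∀ᵐ ω ∂P, ω ∈ B → Z ω = X ω := by
      filter_upwards [hZout] with ω hω hωB
      exact hω fun A hA hωA => Set.disjoint_left.1 (hdB A hA) hωA hωB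
    have hmean : ⨍ x in B, Z x ∂P = ⨍ x in B, X x ∂P := setAverage_congr_fun hBm hZB
    have hint : Integrable (B.piecewise (fun _ => ⨍ x in B, Z x ∂P) Z) P :=
      Integrable.piecewise hBm (integrable_const _).integrableOn
        (L1.integrable_coeFn Z).integrableOn
    let W : Ω →₁[P] ℝ := hint.toL1 _
    have hW : W =ᵐ[P] B.piecewise (fun _ => ⨍ x in B, Z x ∂P) Z := hint.coeFn_toL1
    have hWin : ∀ᵐ ω ∂P, ω ∈ B → W ω = ⨍ x in B, Z x ∂P := by
      filter_upwards [hW] with ω h1 hω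
      rw [h1]; simp [hω]
    have hWout : ∀ᵐ ω ∂P, ω ∉ B → W ω = Z ω := by
      filter_upwards [hW] with ω h1 hω
      rw [h1]; simp [hω]
    obtain ⟨hWD, hWZ⟩ := h.average_le hP hZ hBm (c := c) (Z := W) (by
      filter_upwards [hZB] with ω h1 hω
      rw [h1 hω]; exact hc B (Finset.mem_insert_self _ _) ω hω) hWin hWout
    refine ⟨W, hWD, hWZ.trans hZX, ?_, ?_⟩
    · intro A hA
      rcases Finset.mem_insert.1 hA with rfl | hA
      · rwa [hmean] at hWin
      · filter_upwards [hZin A hA, hWout] with ω h1 h2 hω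
        rw [h2 (Set.disjoint_left.1 (hdB A hA) hω), h1 hω]
    · filter_upwards [hWout, hZout] with ω h1 h2 h3
      rw [h1 (h3 B (Finset.mem_insert_self _ _)),
        h2 fun A hA => h3 A (Finset.mem_insert_of_mem hA)]

theorem LawInvariantRisk.exists_truncated_average [IsProbabilityMeasure P] (hP : Nonatomic P)
    (h : LawInvariantRisk P D ρ) {X : Ω →₁[P] ℝ} (hX : X ∈ D) (π : FinPartition P) (k : ℝ) :
    ∃ Z ∈ D, ρ Z ≤ ρ X ∧ ∀ᵐ ω ∂P, ∀ A ∈ π.parts, ω ∈ A →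
      Z ω = if |X ω| ≤ k then ⨍ x in A ∩ {x | |X x| ≤ k}, X x ∂P else X ω := by
  classical
  have hG : MeasurableSet {x | |X x| ≤ k} :=
    measurableSet_le (Lp.stronglyMeasurable X).measurable.abs measurable_const
  obtain ⟨Z, hZ, hZX, hin, hout⟩ := h.exists_average_finset hP hX (c := k)
    (π.parts.image fun A => A ∩ {x | |X x| ≤ k})
    (by
      intro B hB
      obtain ⟨A, hA, rfl⟩ := Finset.mem_image.1 hB
      exact (π.measurableSet_of_mem A hA).inter hG)
    (by
      intro B hB B' hB' hne
      obtain ⟨A, hA, rfl⟩ := Finset.mem_image.1 (Finset.mem_coe.1 hB)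
      obtain ⟨A', hA', rfl⟩ := Finset.mem_image.1 (Finset.mem_coe.1 hB')
      exact (π.pairwiseDisjoint hA hA' fun e => hne (by rw [e])).mono Set.inter_subset_left
        Set.inter_subset_left)
    (by
      intro B hB ω hω
      obtain ⟨A, hA, rfl⟩ := Finset.mem_image.1 hB
      exact hω.2)
  refine ⟨Z, hZ, hZX, ?_⟩
  filter_upwards [(Filter.eventually_all_finset _).2 hin, hout] with ω h1 h2 A hA hωA
  by_cases hk : |X ω| ≤ k
  · rw [if_pos hk]
    exact h1 _ (Finset.mem_image_of_mem _ hA) ⟨hωA, hk⟩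
  · rw [if_neg hk]
    refine h2 fun B hB hωB => hk ?_
    obtain ⟨A', -, rfl⟩ := Finset.mem_image.1 hB
    exact hωB.2

theorem tendsto_setAverage_truncation [IsFiniteMeasure P] (X : Ω →₁[P] ℝ) {A : Set Ω}
    (hA : MeasurableSet A) (hA0 : P A ≠ 0) :
    Tendsto (fun k : ℕ => ⨍ x in A ∩ {x | |X x| ≤ k}, X x ∂P) atTop (𝓝 (⨍ x in A, X x ∂P)) := by
  have hG : ∀ k : ℕ, MeasurableSet (A ∩ {x | |X x| ≤ k}) := fun k =>
    hA.inter (measurableSet_le (Lp.stronglyMeasurable X).measurable.abs measurable_const)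
  have hmono : Monotone fun k : ℕ => A ∩ {x | |X x| ≤ k} := fun k l hkl x hx =>
    ⟨hx.1, show |X x| ≤ (l : ℝ) from le_trans hx.2 (by exact_mod_cast hkl)⟩
  have hU : ⋃ k : ℕ, A ∩ {x | |X x| ≤ k} = A := by
    rw [← Set.inter_iUnion]
    refine Set.inter_eq_left.2 fun x _ => ?_
    obtain ⟨n, hn⟩ := exists_nat_ge |X x|
    exact Set.mem_iUnion.2 ⟨n, hn⟩
  simp only [setAverage_eq, smul_eq_mul]
  have hmeas := tendsto_measure_iUnion_atTop (μ := P) hmono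
  rw [hU] at hmeas
  refine Tendsto.mul (Tendsto.inv₀ ((ENNReal.tendsto_toReal (measure_ne_top _ _)).comp hmeas)
    ((measureReal_ne_zero_iff (measure_ne_top _ _)).2 hA0)) ?_
  have := tendsto_setIntegral_of_monotone hG hmono (μ := P) (f := X)
    (L1.integrable_coeFn X).integrableOn
  rwa [hU] at this

/-- The truncated averages at level `k` have risk at most `ρ X` and converge a.s. to `E[X|π]`.
Convergent cell means are bounded, so `|X|` plus a constant dominates the sequence. -/
theorem LawInvariantRisk.dilatationMonotoneOn [IsProbabilityMeasure P] (hP : Nonatomic P)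
    (h : LawInvariantRisk P D ρ) : DilatationMonotoneOn D ρ := by
  intro X hX π
  choose Z hZ hZX hZeq using fun k : ℕ => h.exists_truncated_average hP hX π (k : ℝ)
  have hlimA := fun A (hA : A ∈ π.parts) => tendsto_setAverage_truncation X
    (π.measurableSet_of_mem A hA) (π.measure_ne_zero A hA)
  have hbd : ∀ A, ∃ c : ℝ, 0 ≤ c ∧
      (A ∈ π.parts → ∀ k : ℕ, |⨍ x in A ∩ {x | |X x| ≤ k}, X x ∂P| ≤ c) := by
    intro A
    by_cases hA : A ∈ π.parts
    · obtain ⟨c, hc⟩ := (hlimA A hA).abs.bddAbove_range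
      exact ⟨c, (abs_nonneg _).trans (hc ⟨0, rfl⟩), fun _ k => hc ⟨k, rfl⟩⟩
    · exact ⟨0, le_rfl, fun hA' => absurd hA' hA⟩
  choose c hc0 hc using hbd
  refine (h.le_liminf hX (c := ∑ A ∈ π.parts, c A) hZ (h.condE_mem π X) ?_ fun n => ?_).trans
    (liminf_le_of_frequently_le' (Frequently.of_forall hZX))
  · filter_upwards [ae_all_iff.2 hZeq, condE_ae_eq π X] with ω h1 h2
    obtain ⟨A, hA, hωA⟩ := π.exists_mem ω
    rw [h2 A hA hωA]
    refine (hlimA A hA).congr' ?_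
    obtain ⟨n, hn⟩ := exists_nat_ge |X ω|
    filter_upwards [eventually_ge_atTop n] with k hk
    rw [h1 k A hA hωA, if_pos (hn.trans (by exact_mod_cast hk))]
  · filter_upwards [hZeq n] with ω h1
    obtain ⟨A, hA, hωA⟩ := π.exists_mem ω
    rw [h1 A hA hωA]
    have hs : c A ≤ ∑ A ∈ π.parts, c A := Finset.single_le_sum (fun A _ => hc0 A) hA
    split_ifs
    · linarith [hc A hA n, abs_nonneg (X ω)]
    · linarith [hc0 A]

/-! ### Approximation by conditional expectations; agreement on the domain. -/

/-- A finite partition of the line into the tail `{|x| > M}` and cells of length at most `δ`. -/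
theorem exists_discretization (M : ℝ) {δ : ℝ} (hδ : 0 < δ) :
    ∃ q : SimpleFunc ℝ ℤ, (∀ x y, |x| ≤ M → q x = q y → |y| ≤ M ∧ |y - x| ≤ δ) ∧
      ∀ x y, M < |x| → M < |y| → q x = q y := by
  classical
  -- The tail label `⌊M / δ⌋ + 1` exceeds every label used on `|x| ≤ M`.
  let f : ℝ → ℤ := fun x => if |x| ≤ M then ⌊x / δ⌋ else ⌊M / δ⌋ + 1
  have hle : ∀ x, |x| ≤ M → ⌊x / δ⌋ ≤ ⌊M / δ⌋ := fun x hx =>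
    Int.floor_le_floor (by have := le_of_abs_le hx; gcongr)
  have hge : ∀ x, |x| ≤ M → ⌊-M / δ⌋ ≤ ⌊x / δ⌋ := fun x hx =>
    Int.floor_le_floor (by have := neg_le_of_abs_le hx; gcongr)
  have hfm : Measurable f :=
    Measurable.ite (measurableSet_le measurable_id.abs measurable_const)
      (Int.measurable_floor.comp (measurable_id.div_const δ)) measurable_const
  have hfin : (Set.range f).Finite := by
    refine ((Set.finite_Icc ⌊-M / δ⌋ ⌊M / δ⌋).insert (⌊M / δ⌋ + 1)).subset ?_
    rintro _ ⟨x, rfl⟩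
    by_cases hx : |x| ≤ M
    · exact Or.inr (by simpa only [f, if_pos hx] using ⟨hge x hx, hle x hx⟩)
    · exact Or.inl (by simp only [f, if_neg hx])
  refine ⟨⟨f, fun k => hfm (measurableSet_singleton k), hfin⟩, fun x y hx hxy => ?_,
    fun x y hx hy => ?_⟩
  · have hxy' : f x = f y := hxy
    by_cases hy : |y| ≤ M
    · refine ⟨hy, ?_⟩
      simp only [f, if_pos hx, if_pos hy] at hxy'
      have := Int.abs_sub_lt_one_of_floor_eq_floor hxy'.symm
      rw [← sub_div, abs_div, abs_of_pos hδ, div_lt_one hδ] at this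
      exact this.le
    · simp only [f, if_pos hx, if_neg hy] at hxy'
      have := hle x hx
      omega
  · show f x = f y
    simp only [f, if_neg hx.not_ge, if_neg hy.not_ge]

theorem exists_tail_le (X : Ω →₁[P] ℝ) {ε : ℝ} (hε : 0 < ε) :
    ∃ M : ℝ, 1 ≤ M ∧ ∫ x in {x | M < |X x|}, |X x| ∂P ≤ ε := by
  have hm : ∀ k : ℕ, MeasurableSet {x | (k : ℝ) < |X x|} := fun k =>
    measurableSet_lt measurable_const (Lp.stronglyMeasurable X).measurable.abs
  have hanti : Antitone fun k : ℕ => {x | (k : ℝ) < |X x|} := fun k l hkl x hx =>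
    show (k : ℝ) < |X x| from lt_of_le_of_lt (by exact_mod_cast hkl) hx
  have hI : ⋂ k : ℕ, {x | (k : ℝ) < |X x|} = ∅ := by
    refine Set.eq_empty_of_forall_notMem fun x hx => ?_
    obtain ⟨n, hn⟩ := exists_nat_ge |X x|
    exact absurd (Set.mem_iInter.1 hx n : (n : ℝ) < |X x|) hn.not_gt
  have hlim := tendsto_setIntegral_of_antitone hm hanti
    ⟨0, (L1.integrable_coeFn X).abs.integrableOn⟩
  rw [hI, setIntegral_empty] at hlim
  obtain ⟨k, hk1, hk2⟩ := ((hlim.eventually_le_const hε).and (eventually_ge_atTop 1)).exists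
  exact ⟨k, by exact_mod_cast hk2, hk1⟩

theorem abs_setAverage_sub_le [IsFiniteMeasure P] {X : Ω → ℝ} (hX : Integrable X P) {S : Set Ω}
    (hS : MeasurableSet S) (hS0 : P S ≠ 0) {v δ : ℝ} (h : ∀ ω ∈ S, |X ω - v| ≤ δ) :
    |(⨍ x in S, X x ∂P) - v| ≤ δ := by
  have := (convex_closedBall v δ).set_average_mem Metric.isClosed_closedBall hS0
    (measure_ne_top P S) ((ae_restrict_iff' hS).2 (Eventually.of_forall fun ω hω => by
      rw [Metric.mem_closedBall, Real.dist_eq]; exact h ω hω)) hX.integrableOn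
  rwa [Metric.mem_closedBall, Real.dist_eq] at this

theorem abs_setAverage_mul_le [IsFiniteMeasure P] {X : Ω → ℝ} (S : Set Ω) :
    |⨍ x in S, X x ∂P| * P.real S ≤ ∫ x in S, |X x| ∂P := by
  rw [setAverage_eq, smul_eq_mul, abs_mul, abs_inv, abs_of_nonneg measureReal_nonneg]
  have h1 : |∫ x in S, X x ∂P| ≤ ∫ x in S, |X x| ∂P := abs_integral_le_integral_abs
  rcases eq_or_ne (P.real S) 0 with h | h
  · rw [h, mul_zero]; exact (abs_nonneg _).trans h1
  · rwa [mul_comm, mul_inv_cancel_left₀ h]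

/-- Every `X` in `L¹` is approximated by its conditional expectations given finite partitions, up
to an arbitrarily small exceptional set on which these stay bounded. -/
theorem exists_condE_approx [IsProbabilityMeasure P] (hP : Nonatomic P) (X : Ω →₁[P] ℝ) {K : ℝ}
    (hK : 1 / 2 ≤ P.real {x | |X x| ≤ K}) {ε : ℝ} (hε : 0 < ε) (hε' : ε ≤ 1 / 2) :
    ∃ (π : FinPartition P) (C : Set Ω), P C ≤ ENNReal.ofReal (2 * ε) ∧
      ∀ᵐ ω ∂P, (ω ∈ C → |condE π X ω| ≤ K + 1) ∧ (ω ∉ C → |condE π X ω - X ω| ≤ ε) := by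
  classical
  have hXm := (Lp.stronglyMeasurable X).measurable
  have hXi := L1.integrable_coeFn X
  obtain ⟨M, hM1, hM⟩ := exists_tail_le X hε
  -- Ballast for the tail: `|X| ≤ K` on `B` and `P B = ε`, while the tail integral is at most `ε`.
  -- So `|X|` integrates over `B ∪ T` to at most `(K + 1) ε`, and its mean there is at most `K + 1`.
  obtain ⟨B, hBK, hB, hBε⟩ := hP.exists_measure_eq
    (measurableSet_le hXm.abs (measurable_const (a := K))) (t := ENNReal.ofReal ε)
    (by
      rw [← ofReal_measureReal]
      exact ENNReal.ofReal_le_ofReal (hε'.trans hK))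
  have hBr : P.real B = ε := by rw [measureReal_def, hBε, ENNReal.toReal_ofReal hε.le]
  set T : Set Ω := {x | M < |X x|} with hTdef
  have hT : MeasurableSet T := measurableSet_lt measurable_const hXm.abs
  have hTr : P.real T ≤ ε := by
    refine le_trans ?_ hM
    rw [← mul_one (P.real T), ← smul_eq_mul, ← setIntegral_const]
    exact setIntegral_mono_on (integrable_const _).integrableOn hXi.abs.integrableOn hT
      fun x hx => hM1.trans (le_of_lt hx)
  have hC : MeasurableSet (B ∪ T) := hB.union hT
  obtain ⟨q, hq, -⟩ := exists_discretization M hε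
  let f : SimpleFunc Ω (Option ℤ) :=
    SimpleFunc.piecewise (B ∪ T) hC (SimpleFunc.const Ω none) ((q.comp X hXm).map some)
  have hfin : ∀ ω ∈ B ∪ T, f ω = none := fun ω hω =>
    (SimpleFunc.piecewise_apply hC _ _ ω).trans (if_pos hω)
  have hfout : ∀ ω ∉ B ∪ T, f ω = some (q (X ω)) := fun ω hω =>
    (SimpleFunc.piecewise_apply hC _ _ ω).trans (if_neg hω)
  obtain ⟨π, hπ⟩ := exists_finPartition_of_simpleFunc (P := P) f
  refine ⟨π, B ∪ T, ?_, ?_⟩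
  · rw [← ofReal_measureReal]
    refine ENNReal.ofReal_le_ofReal ((measureReal_union_le B T).trans ?_)
    linarith
  · filter_upwards [hπ X, ae_measure_fiber_ne_zero (P := P) f] with ω h1 h2
    rw [h1]
    constructor
    · intro hω
      have hfib : f ⁻¹' {f ω} = B ∪ T := by
        ext ω'
        rw [Set.mem_preimage, Set.mem_singleton_iff, hfin ω hω]
        by_cases hω' : ω' ∈ B ∪ T
        · simp [hω', hfin ω' hω']
        · simp [hω', hfout ω' hω']
      rw [hfib]
      have hpos : 0 < P.real (B ∪ T) :=
        lt_of_lt_of_le (hBr ▸ hε) (measureReal_mono Set.subset_union_left)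
      have hK0 : 0 ≤ K := by
        by_contra hneg
        have : {x | |X x| ≤ K} = ∅ := Set.eq_empty_of_forall_notMem fun x hx =>
          hneg ((abs_nonneg _).trans hx)
        rw [this] at hK
        norm_num at hK
      have hIB : ∫ x in B, |X x| ∂P ≤ K * ε := by
        have := setIntegral_mono_on (μ := P) hXi.abs.integrableOn
          (integrable_const K).integrableOn hB fun x hx => hBK hx
        rwa [setIntegral_const, hBr, smul_eq_mul, mul_comm] at this
      have hIC : ∫ x in B ∪ T, |X x| ∂P ≤ ∫ x in B, |X x| ∂P + ∫ x in T, |X x| ∂P := by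
        have hdisj : Disjoint B (T \ B) := Set.disjoint_sdiff_right
        rw [← Set.union_sdiff_self, setIntegral_union hdisj (hT.diff hB)
          hXi.abs.integrableOn hXi.abs.integrableOn]
        exact add_le_add le_rfl (setIntegral_mono_set hXi.abs.integrableOn
          (Eventually.of_forall fun _ => abs_nonneg _) Set.sdiff_subset.eventuallyLE)
      refine le_of_mul_le_mul_right ((abs_setAverage_mul_le _).trans ?_) hpos
      calc ∫ x in B ∪ T, |X x| ∂P ≤ (K + 1) * P.real B := by rw [hBr]; linarith
        _ ≤ (K + 1) * P.real (B ∪ T) :=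
            mul_le_mul_of_nonneg_left (measureReal_mono Set.subset_union_left) (by linarith)
    · intro hω
      refine abs_setAverage_sub_le hXi (f.measurableSet_fiber _) h2 fun ω' hω' => ?_
      have hω'C : ω' ∉ B ∪ T := by
        intro hmem
        have : f ω' = f ω := hω'
        rw [hfin ω' hmem, hfout ω hω] at this
        exact absurd this (by simp)
      have hqq : q (X ω) = q (X ω') := by
        have : f ω' = f ω := hω'
        rw [hfout ω' hω'C, hfout ω hω] at this
        exact (Option.some_injective _ this).symm
      exact (hq _ _ (not_lt.1 fun hlt => hω (Or.inr hlt)) hqq).2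

theorem exists_half_le_measureReal [IsProbabilityMeasure P] (X : Ω →₁[P] ℝ) :
    ∃ K : ℝ, 1 / 2 ≤ P.real {x | |X x| ≤ K} := by
  have hmono : Monotone fun k : ℕ => {x | |X x| ≤ (k : ℝ)} := fun k l hkl x hx =>
    show |X x| ≤ (l : ℝ) from le_trans hx (by exact_mod_cast hkl)
  have hU : ⋃ k : ℕ, {x | |X x| ≤ (k : ℝ)} = Set.univ :=
    Set.eq_univ_of_forall fun x => by
      obtain ⟨n, hn⟩ := exists_nat_ge |X x|
      exact Set.mem_iUnion.2 ⟨n, hn⟩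
  have h := (ENNReal.tendsto_toReal (measure_ne_top P _)).comp
    (tendsto_measure_iUnion_atTop (μ := P) hmono)
  rw [hU, measure_univ, ENNReal.toReal_one] at h
  obtain ⟨k, hk⟩ := (h.eventually_const_le (show (1 / 2 : ℝ) < 1 by norm_num)).exists
  exact ⟨k, hk⟩

/-- With `ε = 2^-(n+1)` the exceptional sets have summable probabilities, so by Borel–Cantelli the
conditional expectations converge to `X` a.s. They are dominated by `|X| + |K| + 2`, and Fatou
applies. -/
theorem LawInvariantRisk.le_extend [IsProbabilityMeasure P] (hP : Nonatomic P)
    (h : LawInvariantRisk P D ρ) {X : Ω →₁[P] ℝ} (hX : X ∈ D) : ρ X ≤ extend ρ X := by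
  obtain ⟨K, hK⟩ := exists_half_le_measureReal X
  have hε : ∀ n : ℕ, (0 : ℝ) < (1 / 2) ^ (n + 1) := fun n => by positivity
  have hε' : ∀ n : ℕ, (1 / 2 : ℝ) ^ (n + 1) ≤ 1 / 2 := fun n => by
    rw [pow_succ]
    have : (1 / 2 : ℝ) ^ n ≤ 1 := pow_le_one₀ (by norm_num) (by norm_num)
    linarith
  choose π C hC happ using fun n => exists_condE_approx hP X hK (hε n) (hε' n)
  have hsum : ∑' n, P (C n) ≠ ∞ := by
    refine ne_top_of_le_ne_top ?_ (ENNReal.tsum_le_tsum hC)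
    have hs : Summable fun n : ℕ => 2 * (1 / 2 : ℝ) ^ (n + 1) :=
      ((summable_nat_add_iff 1).2 (summable_geometric_of_lt_one (by norm_num) 
        (by norm_num))).mul_left 2
    rw [← ENNReal.ofReal_tsum_of_nonneg (fun n => by positivity) hs]
    exact ENNReal.ofReal_ne_top
  refine (h.le_liminf hX (c := |K| + 2) (fun n => h.condE_mem (π n) X) hX ?_ fun n => ?_).trans
    (liminf_le_of_frequently_le' (Frequently.of_forall fun n =>
      le_iSup (fun π => ρ (condE π X)) (π n)))
  · filter_upwards [ae_all_iff.2 happ, ae_eventually_notMem hsum] with ω h1 h2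
    rw [tendsto_iff_dist_tendsto_zero]
    refine squeeze_zero' (Eventually.of_forall fun _ => dist_nonneg)
      (h2.mono fun n hn => (h1 n).2 hn) ?_
    exact (tendsto_pow_atTop_nhds_zero_of_lt_one (r := (1 / 2 : ℝ)) (by norm_num)
      (by norm_num)).comp (tendsto_add_atTop_nat 1)
  · filter_upwards [happ n] with ω h1
    by_cases hω : ω ∈ C n
    · linarith [h1.1 hω, le_abs_self K, abs_nonneg (X ω)]
    · have h2 := abs_sub_abs_le_abs_sub (condE (π n) X ω) (X ω)
      linarith [h1.2 hω, hε' n, abs_nonneg K]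

theorem LawInvariantRisk.extend_eq [IsProbabilityMeasure P] (hP : Nonatomic P)
    (h : LawInvariantRisk P D ρ) {X : Ω →₁[P] ℝ} (hX : X ∈ D) : extend ρ X = ρ X :=
  le_antisymm (iSup_le fun π => h.dilatationMonotoneOn hP X hX π) (h.le_extend hP hX)

/-! ### Law-invariance and lower semicontinuity of the extension. -/

/-- `ρ(E[X | π])` is lower semicontinuous in the cell integrals of `X`. -/
theorem LawInvariantRisk.condE_le_liminf [IsFiniteMeasure P] (h : LawInvariantRisk P D ρ)
    (π : FinPartition P) {X : ℕ → (Ω →₁[P] ℝ)} {X₀ : Ω →₁[P] ℝ}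
    (hX : ∀ A ∈ π.parts, Tendsto (fun n => ∫ x in A, X n x ∂P) atTop (𝓝 (∫ x in A, X₀ x ∂P))) :
    ρ (condE π X₀) ≤ liminf (fun n => ρ (condE π (X n))) atTop := by
  have hlim : ∀ A ∈ π.parts,
      Tendsto (fun n => ⨍ x in A, X n x ∂P) atTop (𝓝 (⨍ x in A, X₀ x ∂P)) := by
    intro A hA
    simp only [setAverage_eq, smul_eq_mul]
    exact (hX A hA).const_mul _
  have hbd : ∀ A, ∃ c : ℝ, 0 ≤ c ∧ (A ∈ π.parts → ∀ n : ℕ, |⨍ x in A, X n x ∂P| ≤ c) := by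
    intro A
    by_cases hA : A ∈ π.parts
    · obtain ⟨c, hc⟩ := (hlim A hA).abs.bddAbove_range
      exact ⟨c, (abs_nonneg _).trans (hc ⟨0, rfl⟩), fun _ k => hc ⟨k, rfl⟩⟩
    · exact ⟨0, le_rfl, fun hA' => absurd hA' hA⟩
  choose c hc0 hc using hbd
  refine h.le_liminf (h.condE_mem π X₀) (c := ∑ A ∈ π.parts, c A) (fun n => h.condE_mem π (X n))
    (h.condE_mem π X₀) ?_ fun n => ?_
  · filter_upwards [ae_all_iff.2 fun n => condE_ae_eq π (X n), condE_ae_eq π X₀] with ω h1 h2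
    obtain ⟨A, hA, hωA⟩ := π.exists_mem ω
    simp only [h2 A hA hωA, h1 _ A hA hωA]
    exact hlim A hA
  · filter_upwards [condE_ae_eq π (X n)] with ω h1
    obtain ⟨A, hA, hωA⟩ := π.exists_mem ω
    rw [h1 A hA hωA]
    have hs : c A ≤ ∑ A ∈ π.parts, c A := Finset.single_le_sum (fun A _ => hc0 A) hA
    linarith [hc A hA n, abs_nonneg (condE π X₀ ω)]

/-- The partition generated by discretizing `X`: the conditional expectation is a function of `X`
depending only on its law, and it is close to `X` in `L¹`. -/
theorem exists_condE_of_discretization [IsProbabilityMeasure P] (X : Ω →₁[P] ℝ) {ε M : ℝ}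
    (hM : ∫ x in {x | M < |X x|}, |X x| ∂P ≤ ε) {q : SimpleFunc ℝ ℤ}
    (hq : ∀ x y, |x| ≤ M → q x = q y → |y| ≤ M ∧ |y - x| ≤ ε)
    (hq' : ∀ x y, M < |x| → M < |y| → q x = q y) :
    ∃ π : FinPartition P,
      (∀ᵐ ω ∂P, condE π X ω = ⨍ x in q ⁻¹' {q (X ω)}, x ∂(P.map X)) ∧
      ∫ ω, |condE π X ω - X ω| ∂P ≤ 3 * ε := by
  have hXm := (Lp.stronglyMeasurable X).measurable
  have hXi := L1.integrable_coeFn X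
  obtain ⟨π, hπ⟩ := exists_finPartition_of_simpleFunc (P := P) (q.comp X hXm)
  refine ⟨π, ?_, ?_⟩
  · filter_upwards [hπ X] with ω hω
    rw [hω, setAverage_eq, setAverage_eq, setIntegral_map (f := fun t => t)
      (q.measurableSet_fiber _) aestronglyMeasurable_id hXm.aemeasurable, map_measureReal_apply hXm
      (q.measurableSet_fiber _)]
    rfl
  · set T : Set Ω := {x | M < |X x|} with hTdef
    have hT : MeasurableSet T := measurableSet_lt measurable_const hXm.abs
    have hVi := L1.integrable_coeFn (condE π X)
    have hε : 0 ≤ ε := (integral_nonneg fun _ => abs_nonneg _).trans hM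
    -- The tail is a single cell, on which `X` and its mean each contribute at most `ε`; off the
    -- tail the pointwise error is at most `ε`.
    have h1 : ∫ ω in T, |condE π X ω - X ω| ∂P ≤ 2 * ε := by
      have hT1 : ∫ ω in T, |condE π X ω| ∂P ≤ ε := by
        have hTa : ∀ᵐ ω ∂P, ω ∈ T → |condE π X ω| = |⨍ x in T, X x ∂P| := by
          filter_upwards [hπ X] with ω hω hωT
          have hfib : (q.comp X hXm) ⁻¹' {(q.comp X hXm) ω} = T := by
            ext ω'
            constructor
            · intro hω'
              have e : q (X ω') = q (X ω) := hω'
              by_contra hn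
              exact absurd (hq _ _ (not_lt.1 hn) e).1 (not_le.2 hωT)
            · exact fun hω' => hq' _ _ hω' hωT
          rw [hω, hfib]
        rw [setIntegral_congr_ae hT hTa, setIntegral_const, smul_eq_mul, mul_comm]
        exact (abs_setAverage_mul_le _).trans hM
      calc ∫ ω in T, |condE π X ω - X ω| ∂P ≤ ∫ ω in T, (|condE π X ω| + |X ω|) ∂P :=
            integral_mono (hVi.sub hXi).abs.integrableOn (hVi.abs.add hXi.abs).integrableOn
              fun ω => abs_sub _ _
        _ = ∫ ω in T, |condE π X ω| ∂P + ∫ ω in T, |X ω| ∂P :=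
            integral_add hVi.abs.integrableOn hXi.abs.integrableOn
        _ ≤ 2 * ε := by linarith
    have h2 : ∫ ω in Tᶜ, |condE π X ω - X ω| ∂P ≤ ε := by
      have hTc : ∀ᵐ ω ∂P, ω ∈ Tᶜ → |condE π X ω - X ω| ≤ ε := by
        filter_upwards [hπ X, ae_measure_fiber_ne_zero (P := P) (q.comp X hXm)] with ω h1 h2 hω
        rw [h1]
        refine abs_setAverage_sub_le hXi (SimpleFunc.measurableSet_fiber _ _) h2 fun ω' hω' => ?_
        have e : q (X ω') = q (X ω) := hω'
        exact (hq _ _ (not_lt.1 hω) e.symm).2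
      calc ∫ ω in Tᶜ, |condE π X ω - X ω| ∂P ≤ ∫ _ in Tᶜ, ε ∂P :=
            setIntegral_mono_on_ae (hVi.sub hXi).abs.integrableOn
              (integrable_const _).integrableOn hT.compl hTc
        _ = P.real Tᶜ * ε := by rw [setIntegral_const, smul_eq_mul]
        _ ≤ ε := mul_le_of_le_one_left hε measureReal_le_one
    have hsplit := integral_add_compl hT (hVi.sub hXi).abs
    simp only [Pi.sub_apply] at hsplit
    linarith

theorem tail_integral_eq {X Y : Ω → ℝ} (h : IdentDistrib X Y P P) (hX : Measurable X)
    (hY : Measurable Y) (M : ℝ) :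
    ∫ x in {x | M < |X x|}, |X x| ∂P = ∫ x in {x | M < |Y x|}, |Y x| ∂P := by
  have hs : MeasurableSet {t : ℝ | M < |t|} := measurableSet_lt measurable_const measurable_id.abs
  have key : ∀ Z : Ω → ℝ, Measurable Z →
      ∫ x in {x | M < |Z x|}, |Z x| ∂P = ∫ t in {t : ℝ | M < |t|}, |t| ∂(P.map Z) := by
    intro Z hZ
    rw [setIntegral_map (f := fun t => |t|) hs measurable_id.abs.aestronglyMeasurable hZ.aemeasurable]
    rfl
  rw [key X hX, key Y hY, h.map_eq]

/-- One discretization of the line serves both variables: it gives `V n → X` in `L¹`, each `V n`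
having the law of a conditional expectation of `Y`, so `ρ (V n) ≤ ρ̄ Y`. For fixed `π`, dilatation
monotonicity gives `ρ(E[V n|π]) ≤ ρ̄ Y`, and the limit gives `ρ(E[X|π]) ≤ ρ̄ Y`. -/
theorem LawInvariantRisk.extend_lawInvariantOn [IsProbabilityMeasure P] (hP : Nonatomic P)
    (h : LawInvariantRisk P D ρ) : LawInvariantOn Set.univ (extend ρ) := by
  have key : ∀ X Y : Ω →₁[P] ℝ, IdentDistrib (X : Ω → ℝ) (Y : Ω → ℝ) P P →
      extend ρ X ≤ extend ρ Y := by
    intro X Y hXY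
    have hXm := (Lp.stronglyMeasurable X).measurable
    have hYm := (Lp.stronglyMeasurable Y).measurable
    have happ : ∀ n : ℕ, ∃ V : Ω →₁[P] ℝ, V ∈ D ∧ ρ V ≤ extend ρ Y ∧
        ∫ ω, |V ω - X ω| ∂P ≤ 3 * (1 / ((n : ℝ) + 1)) := by
      intro n
      have hε : (0 : ℝ) < 1 / ((n : ℝ) + 1) := by positivity
      obtain ⟨M, -, hM⟩ := exists_tail_le X hε
      obtain ⟨q, hq, hq'⟩ := exists_discretization M hε
      obtain ⟨π, hπ, hπ1⟩ := exists_condE_of_discretization X hM hq hq'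
      obtain ⟨π', hπ', -⟩ := exists_condE_of_discretization Y
        ((tail_integral_eq hXY hXm hYm M).symm.trans_le hM) hq hq'
      refine ⟨condE π X, h.condE_mem π X, ?_, hπ1⟩
      rw [← hXY.map_eq] at hπ'
      have hg : Measurable fun t : ℝ => ⨍ x in q ⁻¹' {q t}, x ∂(P.map X) :=
        (measurable_from_top (f := fun z : ℤ => ⨍ x in q ⁻¹' {z}, x ∂(P.map X))).comp q.measurable
      have hid : IdentDistrib (condE π X : Ω → ℝ) (condE π' Y : Ω → ℝ) P P :=
        (IdentDistrib.of_ae_eq (Lp.aestronglyMeasurable _).aemeasurable hπ).trans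
          ((hXY.comp hg).trans
            (IdentDistrib.of_ae_eq (Lp.aestronglyMeasurable _).aemeasurable hπ').symm)
      rw [h.law _ (h.condE_mem π X) _ (h.condE_mem π' Y) hid]
      exact le_iSup (fun π => ρ (condE π Y)) π'
    choose V hV hVY hVX using happ
    refine iSup_le fun π => ?_
    refine (h.condE_le_liminf π (X := V) fun A hA => ?_).trans
      (liminf_le_of_frequently_le' (Frequently.of_forall fun n =>
        (h.dilatationMonotoneOn hP _ (hV n) π).trans (hVY n)))
    rw [tendsto_iff_dist_tendsto_zero]
    have hlim : Tendsto (fun n : ℕ => 3 * (1 / ((n : ℝ) + 1))) atTop (𝓝 (3 * 0)) :=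
      tendsto_one_div_add_atTop_nhds_zero_nat.const_mul 3
    rw [mul_zero] at hlim
    refine squeeze_zero (fun _ => dist_nonneg) (fun n => ?_) hlim
    have hVi := L1.integrable_coeFn (V n)
    have hXi := L1.integrable_coeFn X
    rw [Real.dist_eq, ← integral_sub hVi.integrableOn hXi.integrableOn]
    refine (abs_integral_le_integral_abs).trans ((setIntegral_le_integral (hVi.sub hXi).abs
      (Eventually.of_forall fun _ => abs_nonneg _)).trans (hVX n))
  exact fun X _ Y _ hXY => le_antisymm (key X Y hXY) (key Y X hXY.symm)

theorem LawInvariantRisk.extend_sigmaLowerSemicontinuous [IsProbabilityMeasure P]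
    (h : LawInvariantRisk P D ρ) : SigmaLowerSemicontinuous (extend ρ) := by
  classical
  intro r
  have hset : {X | extend ρ X ≤ (r : EReal)} =
      ⋂ π : FinPartition P, {X | ρ (condE π X) ≤ (r : EReal)} := by
    ext X
    simp [extend, iSup_le_iff]
  rw [hset]
  refine @isClosed_iInter _ _ (sigmaTopology P) _ fun π => ?_
  let Φ : (Ω →₁[P] ℝ) → (π.parts → ℝ) := fun X A => ∫ x in (A : Set Ω), X x ∂P
  have hΦ : @Continuous _ _ (sigmaTopology P) _ Φ := by
    refine @continuous_pi _ _ _ (sigmaTopology P) _ _ fun A => ?_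
    have hA := π.measurableSet_of_mem A.1 A.2
    let g : SimpleFunc Ω ℝ := SimpleFunc.piecewise A.1 hA (SimpleFunc.const Ω 1)
      (SimpleFunc.const Ω 0)
    have hg : (fun X : Ω →₁[P] ℝ => ∫ x in (A : Set Ω), X x ∂P) = fun X => ∫ ω, X ω * g ω ∂P := by
      funext X
      rw [← integral_indicator hA]
      congr 1
      funext ω
      by_cases hω : ω ∈ A.1 <;> simp [g, hω]
    show @Continuous _ _ (sigmaTopology P) _ fun X : Ω →₁[P] ℝ => ∫ x in (A : Set Ω), X x ∂P
    rw [hg]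
    have hc : @Continuous _ _ (sigmaTopology P) _
        fun (X : Ω →₁[P] ℝ) (g : SimpleFunc Ω ℝ) => ∫ ω, X ω * g ω ∂P := continuous_induced_dom
    exact (@continuous_pi_iff _ _ _ (sigmaTopology P) _ _).1 hc g
  -- It suffices to prove closedness in the coarser topology induced by the finitely many cell
  -- integrals, where closures are described by sequences and Fatou can be used.
  refine IsClosed.mono ?_ (continuous_iff_le_induced.1 hΦ)
  let : TopologicalSpace (Ω →₁[P] ℝ) := TopologicalSpace.induced Φ inferInstance
  refine isClosed_of_closure_subset fun X hX => ?_
  rw [closure_induced, mem_closure_iff_seq_limit] at hX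
  obtain ⟨v, hv, hlim⟩ := hX
  choose Y hY hYv using hv
  refine (h.condE_le_liminf π (X := Y) fun A hA => ?_).trans
    (liminf_le_of_frequently_le' (Frequently.of_forall hY))
  have := (tendsto_pi_nhds.1 hlim) ⟨A, hA⟩
  simp only [← hYv] at this
  exact this

/-! ### Properties inherited through conditional expectation. -/

theorem condE_coeFn (π : FinPartition P) (X : Ω →₁[P] ℝ) :
    condE π X =ᵐ[P] P[(X : Ω → ℝ)|π.sigma] :=
  Integrable.coeFn_toL1 _

theorem condE_add (π : FinPartition P) (X Y : Ω →₁[P] ℝ) :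
    condE π (X + Y) = condE π X + condE π Y := by
  refine Lp.ext ?_
  filter_upwards [condE_coeFn π (X + Y), condE_coeFn π X, condE_coeFn π Y,
    Lp.coeFn_add (condE π X) (condE π Y), condExp_congr_ae (m := π.sigma) (Lp.coeFn_add X Y),
    condExp_add (L1.integrable_coeFn X) (L1.integrable_coeFn Y) π.sigma]
    with ω h1 h2 h3 h4 h5 h6
  rw [h1, h4, h5, h6, Pi.add_apply, Pi.add_apply, h2, h3]

theorem condE_smul (π : FinPartition P) (a : ℝ) (X : Ω →₁[P] ℝ) :
    condE π (a • X) = a • condE π X := by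
  refine Lp.ext ?_
  filter_upwards [condE_coeFn π (a • X), condE_coeFn π X, Lp.coeFn_smul a (condE π X),
    condExp_congr_ae (m := π.sigma) (Lp.coeFn_smul a X),
    condExp_smul (μ := P) a (X : Ω → ℝ) π.sigma] with ω h1 h2 h3 h4 h5
  rw [h1, h3, h4, h5, Pi.smul_apply, Pi.smul_apply, h2]

theorem condE_mono (π : FinPartition P) {X Y : Ω →₁[P] ℝ} (h : Y ≤ X) :
    condE π Y ≤ condE π X := by
  rw [← Lp.coeFn_le]
  filter_upwards [condE_coeFn π X, condE_coeFn π Y, condExp_mono (m := π.sigma)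
    (L1.integrable_coeFn Y) (L1.integrable_coeFn X) ((Lp.coeFn_le Y X).2 h)] with ω h1 h2 h3
  rwa [h1, h2]

theorem condE_const [IsFiniteMeasure P] (π : FinPartition P) (s : ℝ) :
    condE π (Lp.const 1 P s) = Lp.const 1 P s := by
  refine Lp.ext ?_
  filter_upwards [condE_coeFn π (Lp.const 1 P s), Lp.coeFn_const 1 P s,
    condExp_congr_ae (m := π.sigma) (Lp.coeFn_const 1 P s)] with ω h1 h2 h3
  rw [h1, h2, h3]
  exact congrFun (condExp_const π.sigma_le s) ω

/-- The partition with the single member `Ω`. -/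
def trivialPartition (P : Measure Ω) [IsProbabilityMeasure P] : FinPartition P where
  parts := {Set.univ}
  measurableSet_of_mem := by simp
  measure_ne_zero := by simp
  pairwiseDisjoint := by simp
  sUnion_eq := by simp

theorem LawInvariantRisk.extend_ne_bot [IsProbabilityMeasure P] (h : LawInvariantRisk P D ρ)
    (hbot : ∀ X ∈ D, ρ X ≠ ⊥) (X : Ω →₁[P] ℝ) : extend ρ X ≠ ⊥ := fun e =>
  hbot _ (h.condE_mem (trivialPartition P) X)
    (le_bot_iff.1 (e ▸ le_iSup (fun π => ρ (condE π X)) (trivialPartition P)))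

theorem LawInvariantRisk.extend_quasiconvex [IsFiniteMeasure P] (h : LawInvariantRisk P D ρ) :
    RiskQuasiconvexOn Set.univ (extend ρ) := by
  intro X _ Y _ t ht0 ht1 _
  refine iSup_le fun π => ?_
  have e : condE π (t • X + (1 - t) • Y) = t • condE π X + (1 - t) • condE π Y := by
    rw [condE_add, condE_smul, condE_smul]
  have hD := h.condE_mem π (t • X + (1 - t) • Y)
  rw [e] at hD ⊢
  exact (h.quasiconvex _ (h.condE_mem π X) _ (h.condE_mem π Y) t ht0 ht1 hD).trans
    (max_le_max (le_iSup (fun π => ρ (condE π X)) π) (le_iSup (fun π => ρ (condE π Y)) π))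

/-- `E[X|π]` is bounded, hence in the domain, where `ρ̄ = ρ`; and `ρ(E[X|π])` is one of the terms of
the supremum defining `ρ̄ X`. -/
theorem LawInvariantRisk.extend_dilatationMonotone [IsProbabilityMeasure P] (hP : Nonatomic P)
    (h : LawInvariantRisk P D ρ) : DilatationMonotoneOn Set.univ (extend ρ) := by
  intro X _ π
  rw [h.extend_eq hP (h.condE_mem π X)]
  exact le_iSup (fun π => ρ (condE π X)) π

theorem LawInvariantRisk.extend_monotone [IsFiniteMeasure P] (h : LawInvariantRisk P D ρ)
    (hm : RiskMonotoneOn D ρ) : RiskMonotoneOn Set.univ (extend ρ) := fun X _ Y _ hYX =>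
  iSup_mono fun π => hm _ (h.condE_mem π X) _ (h.condE_mem π Y) (condE_mono π hYX)

theorem LawInvariantRisk.extend_convex [IsFiniteMeasure P] (h : LawInvariantRisk P D ρ)
    (hc : RiskConvexOn D ρ) : RiskConvexOn Set.univ (extend ρ) := by
  intro X _ Y _ t ht0 ht1 _
  refine iSup_le fun π => ?_
  have e : condE π (t • X + (1 - t) • Y) = t • condE π X + (1 - t) • condE π Y := by
    rw [condE_add, condE_smul, condE_smul]
  have hD := h.condE_mem π (t • X + (1 - t) • Y)
  rw [e] at hD ⊢
  refine (hc _ (h.condE_mem π X) _ (h.condE_mem π Y) t ht0 ht1 hD).trans (add_le_add ?_ ?_)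
  · exact mul_le_mul_of_nonneg_left (le_iSup (fun π => ρ (condE π X)) π)
      (EReal.coe_nonneg.2 ht0.le)
  · exact mul_le_mul_of_nonneg_left (le_iSup (fun π => ρ (condE π Y)) π)
      (EReal.coe_nonneg.2 (by linarith))

theorem LawInvariantRisk.extend_cashAdditive [IsFiniteMeasure P] (h : LawInvariantRisk P D ρ)
    (hc : CashAdditiveOn D ρ) : CashAdditiveOn Set.univ (extend ρ) := by
  intro X _ s _
  have hterm : ∀ π : FinPartition P,
      ρ (condE π (X + Lp.const 1 P s)) = ρ (condE π X) - (s : EReal) := by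
    intro π
    have e : condE π (X + Lp.const 1 P s) = condE π X + Lp.const 1 P s := by
      rw [condE_add, condE_const]
    have hD := h.condE_mem π (X + Lp.const 1 P s)
    rw [e] at hD ⊢
    exact hc _ (h.condE_mem π X) s hD
  simp only [extend, hterm]
  refine le_antisymm (iSup_le fun π =>
    EReal.sub_le_sub (le_iSup (fun π => ρ (condE π X)) π) le_rfl) ?_
  -- Subtracting `s` commutes with the supremum because `s` is finite.
  rw [EReal.sub_le_iff_le_add (Or.inl (EReal.coe_ne_bot s)) (Or.inl (EReal.coe_ne_top s))]
  refine iSup_le fun π => ?_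
  rw [← EReal.sub_le_iff_le_add (Or.inl (EReal.coe_ne_bot s)) (Or.inl (EReal.coe_ne_top s))]
  exact le_iSup (fun π => ρ (condE π X) - (s : EReal)) π

end RiskExtension

theorem mainTheorem4 {Ω : Type*} [MeasurableSpace Ω] (P : Measure Ω) [IsProbabilityMeasure P]
    (hP : RiskExtension.Nonatomic P)
    (D : Set (Ω →₁[P] ℝ)) (hconv : Convex ℝ D)
    (hadd : ∀ X ∈ D, ∀ Y ∈ D, X + Y ∈ D)
    (hbdd : ∀ X : Ω →₁[P] ℝ, MemLp (X : Ω → ℝ) ∞ P → X ∈ D)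
    (hind : ∀ X ∈ D, ∀ (A : Set Ω) (hA : MeasurableSet A), RiskExtension.mulIndicator X A hA ∈ D)
    (ρ : (Ω →₁[P] ℝ) → EReal) (hbot : ∀ X ∈ D, ρ X ≠ ⊥)
    (hqc : RiskExtension.RiskQuasiconvexOn D ρ)
    (hlaw : RiskExtension.LawInvariantOn D ρ)
    (hfatou : RiskExtension.FatouOn D ρ) :
    RiskExtension.DilatationMonotoneOn D ρ ∧
    (∀ X, RiskExtension.extend ρ X ≠ ⊥) ∧
    (∀ X ∈ D, RiskExtension.extend ρ X = ρ X) ∧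
    RiskExtension.RiskQuasiconvexOn Set.univ (RiskExtension.extend ρ) ∧
    RiskExtension.LawInvariantOn Set.univ (RiskExtension.extend ρ) ∧
    RiskExtension.DilatationMonotoneOn Set.univ (RiskExtension.extend ρ) ∧
    RiskExtension.SigmaLowerSemicontinuous (RiskExtension.extend ρ) ∧
    (RiskExtension.RiskMonotoneOn D ρ →
      RiskExtension.RiskMonotoneOn Set.univ (RiskExtension.extend ρ)) ∧
    (RiskExtension.RiskConvexOn D ρ →
      RiskExtension.RiskConvexOn Set.univ (RiskExtension.extend ρ)) ∧
    (RiskExtension.CashAdditiveOn D ρ →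
      RiskExtension.CashAdditiveOn Set.univ (RiskExtension.extend ρ)) := by
  have h : RiskExtension.LawInvariantRisk P D ρ := ⟨hconv, hadd, hbdd, hind, hqc, hlaw, hfatou⟩
  exact ⟨h.dilatationMonotoneOn hP, h.extend_ne_bot hbot, fun X hX => h.extend_eq hP hX,
    h.extend_quasiconvex, h.extend_lawInvariantOn hP, h.extend_dilatationMonotone hP,
    h.extend_sigmaLowerSemicontinuous, h.extend_monotone, h.extend_convex,
    h.extend_cashAdditive⟩
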